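/- Let $P$ be an integer with $3\nmid P$, and let $\delta=\operatorname{ord}_3(P^2+2)$, i.e. $3^\delta$ is the exact power of $3$ dividing $P^2+2$. Define $(u_n)_{n\ge 0}$ and $(v_n)_{n\ge 0}$ by $u_0=0$, $u_1=1$, $u_n=Pu_{n-1}+u_{n-2}$ and $v_0=2$, $v_1=P$, $v_n=Pv_{n-1}+v_{n-2}$ for $n\ge 2$. For a sequence $x=(x_n)_{n\ge0}$ of integers that is periodic modulo $m$, let $h_x(m)$ be its shortest period modulo $m$, and for an integer $b$ let $$\nu_x(m,b)=\#\{n : 0\le n<h_x(m),\ x_n\equiv b \pmod m\}.$$ Then the following hold for every integer $b$ (in each display the conditions of the different lines, and those for different $l$, are mutually exclusive). 1) If $\delta=1$ and $k\ge 1$, then $$\nu_u(3^k,b)=\begin{cases}3^{\lfloor k/2\rfloor}+2,&\text{if } b\equiv\pm u_{2\cdot 3^{2\lfloor (k-1)/4\rfloor+1}}\pmod{3^k},\\ 2\cdot 3^l+2,&\text{if } b\equiv\pm u_{2\cdot 3^{l-1}}\pmod{3^{2l+1}}\text{ for some }l\in\{1,\dots,\lfloor (k-1)/2\rfloor\},\\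 2,&\text{otherwise,}\end{cases}$$ $$\nu_v(3^k,b)=\begin{cases}3^{\lfloor k/2\rfloor}+2,&\text{if } b\equiv\pm 2\pmod{3^k},\\ 2\cdot 3^l+2,&\text{if } b\equiv\pm v_{4\cdot 3^{l-1}}\pmod{3^{2l+1}}\text{ for some }l\in\{1,\dots,\lfloor (k-1)/2\rfloor\},\\ 2,&\text{otherwise.}\end{cases}$$ 2) If $\delta\ge 2$ and $k\ge 2\delta-1$, then $$\nu_u(3^k,b)=\begin{cases}3^{\lfloor k/2\rfloor},&\text{if } b\equiv\pm u_{2\cdot 3^{2\lfloor (k-2\delta+1)/4\rfloor+1}}\pmod{3^k},\\ 2\cdot 3^l,&\text{if } b\equiv\pm u_{2\cdot 3^{l-\delta}}\pmod{3^{2l+1}}\text{ for some }l\in\{\delta,\dots,\lfloor (k-1)/2\rfloor\},\\ 2,&\text{if } b\equiv 0,\pm 1\pmod{3^\delta},\\ 0,&\text{otherwise,}\end{cases}$$ $$\nu_v(3^k,b)=\begin{cases}3^{\lfloor k/2\rfloor},&\text{if } b\equiv\pm 2\pmod{3^k},\\ 2\cdot 3^l,&\text{if } b\equiv\pm v_{4\cdot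 3^{l-\delta}}\pmod{3^{2l+1}}\text{ for some }l\in\{\delta,\dots,\lfloor (k-1)/2\rfloor\},\\ 2,&\text{if } b\equiv 0,\pm P\pmod{3^\delta},\\ 0,&\text{otherwise.}\end{cases}$$ 3) If $\delta\ge 2$ and $\delta\le k<2\delta-1$, then $$\nu_u(3^k,b)=\begin{cases}3^{k-\delta},&\text{if } b\equiv\pm P\pmod{3^k},\\ 2,&\text{if } b\equiv 0,\pm 1\pmod{3^\delta},\\ 0,&\text{otherwise,}\end{cases}\qquad \nu_v(3^k,b)=\begin{cases}3^{k-\delta},&\text{if } b\equiv\pm 2\pmod{3^k},\\ 2,&\text{if } b\equiv 0,\pm P\pmod{3^\delta},\\ 0,&\text{otherwise.}\end{cases}$$ In particular neither $(u_n)$ nor $(v_n)$ is stable modulo $3$: writing $\Omega_x(m)=\{\nu_x(m,r): 0\le r\le m-1\}$, for $x\in\{u,v\}$ there is no positive integer $k$ such that $\Omega_x(3^N)=\Omega_x(3^k)$ for all integers $N\ge k$. -/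

import Mathlib

/-- The sequence `u_0 = 0`, `u_1 = 1`, `u_n = P u_{n-1} + u_{n-2}`. -/
def lucasU (P : ℤ) : ℕ → ℤ
  | 0 => 0
  | 1 => 1
  | n + 2 => P * lucasU P (n + 1) + lucasU P n

/-- The sequence `v_0 = 2`, `v_1 = P`, `v_n = P v_{n-1} + v_{n-2}`. -/
def lucasV (P : ℤ) : ℕ → ℤ
  | 0 => 2
  | 1 => P
  | n + 2 => P * lucasV P (n + 1) + lucasV P n

/-- The shortest period of the sequence `x` modulo `m`: the least `h > 0` such that
`x (n + h) ≡ x n (mod m)` for all `n` (and `0` if there is no such `h`). -/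
noncomputable def shortestPeriod (x : ℕ → ℤ) (m : ℕ) : ℕ :=
  sInf {h : ℕ | 0 < h ∧ ∀ n : ℕ, x (n + h) ≡ x n [ZMOD (m : ℤ)]}

/-- The number of `n` with `0 ≤ n < h` and `x n ≡ b (mod m)`, where `h` is the shortest
period of `x` modulo `m`. -/
noncomputable def residueFreq (x : ℕ → ℤ) (m : ℕ) (b : ℤ) : ℕ :=
  ((Finset.range (shortestPeriod x m)).filter (fun n => x n ≡ b [ZMOD (m : ℤ)])).card

/-- The set of the frequencies of the residues `0, …, m - 1` in the shortest period of `x`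
modulo `m`. -/
def freqSet (x : ℕ → ℤ) (m : ℕ) : Set ℕ :=
  {f : ℕ | ∃ r : ℕ, r < m ∧ f = residueFreq x m (r : ℤ)}

/-- Stability modulo `p`: the sets of frequencies modulo `p ^ N` are eventually constant. -/
def IsStableMod (x : ℕ → ℤ) (p : ℕ) : Prop :=
  ∃ k : ℕ, 0 < k ∧ ∀ N : ℕ, k ≤ N → freqSet x (p ^ N) = freqSet x (p ^ k)

/-- `b ≡ ± c (mod m)`. -/
def PmModEq (m : ℕ) (b c : ℤ) : Prop :=
  b ≡ c [ZMOD (m : ℤ)] ∨ b ≡ -c [ZMOD (m : ℤ)]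

/-! Everything rests on the factorisations u_{n+2b} - u_n = v_{n+b} u_b and v_{n+2b} - v_n = (P²+4)
u_{n+b} u_b for even b, together with the 3-adic valuations of the factors: δ + ord₃(b) for u_b when
4 ∣ b, δ + ord₃(a) for v_a when a ≡ 2 (mod 4), and 0 at the other indices.

Hence, for n ≡ m (mod 8), the valuation of x_n - x_m is δ + ord₃(n - m), except on one critical
class modulo 4 (2 for u, 0 for v), where both factors are divisible by 3 and it is 2δ + ord₃(n² -
m²). `TernaryLaw` records these facts, so that both sequences are counted by one argument.

Modulo 3^(δ+K) the period is 8·3^K. A regular class modulo 8 meets each residue admissible modulo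
3^δ exactly once (`card_regular_eq`), which gives the frequency 2. On the critical class one counts
the solutions of n² ≡ m² (mod 3^(K-δ)): either m² ≡ 0 and n runs over the multiples of 3^⌈(K-δ)/2⌉
(`card_critical_of_dvd_sq`), or 3^j exactly divides m with 2j < K - δ and n ≡ ±m (mod 3^(K-δ-j))
(`card_critical_of_pow_dvd`); here l = δ + j. A shift of the index by 4·3^K changes the sign of x,
whence the ± in the conditions.

For δ = 1 every residue is regular and the two counts add up; for δ ≥ 2 they concern residues
already distinct modulo 9. Critical frequencies are unbounded, so stability fails. -/

theorem exists_binet (P : ℤ) : ∃ α β : ℝ, α * β = -1 ∧ α - β ≠ 0 ∧ (α - β) ^ 2 = (P : ℝ) ^ 2 + 4 ∧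
    (∀ n, (α - β) * (lucasU P n : ℝ) = α ^ n - β ^ n) ∧ ∀ n, (lucasV P n : ℝ) = α ^ n + β ^ n := by
  have hpos : (0 : ℝ) < (P : ℝ) ^ 2 + 4 := by positivity
  set s := Real.sqrt ((P : ℝ) ^ 2 + 4) with hs
  have hs2 : s ^ 2 = (P : ℝ) ^ 2 + 4 := Real.sq_sqrt hpos.le
  have hs0 : s ≠ 0 := (Real.sqrt_pos.2 hpos).ne'
  have hα : ((P + s) / 2) ^ 2 = P * ((P + s) / 2) + 1 := by linear_combination hs2 / 4
  have hβ : ((P - s) / 2) ^ 2 = P * ((P - s) / 2) + 1 := by linear_combination hs2 / 4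
  refine ⟨(P + s) / 2, (P - s) / 2, by linear_combination -hs2 / 4, ?_, ?_, fun n ↦ ?_, fun n ↦ ?_⟩
  · rwa [show (P + s) / 2 - (P - s) / 2 = s by ring]
  · rw [← hs2]; ring
  · induction n using Nat.twoStepInduction with
    | zero => simp [lucasU]
    | one => simp [lucasU]
    | more n ih1 ih2 =>
      simp only [lucasU]
      push_cast
      rw [pow_add _ n 2, pow_add _ n 2, hα, hβ]
      rw [pow_succ, pow_succ] at ih2
      linear_combination P * ih2 + ih1
  · induction n using Nat.twoStepInduction with
    | zero => norm_num [lucasV]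
    | one => simp [lucasV]; ring
    | more n ih1 ih2 =>
      simp only [lucasV]
      push_cast
      rw [pow_add _ n 2, pow_add _ n 2, hα, hβ]
      rw [pow_succ, pow_succ] at ih2
      linear_combination P * ih2 + ih1

/-- Since αβ = -1 and b is even, (αβ)^b = 1, so the cross terms of the product collapse to terms of
index c. The next three identities hold for the same reason. -/
theorem lucasU_sub {P : ℤ} (c : ℕ) {b : ℕ} (hb : Even b) :
    lucasU P (c + 2 * b) - lucasU P c = lucasV P (c + b) * lucasU P b := by
  obtain ⟨α, β, h1, h0, -, hU, hV⟩ := exists_binet P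
  have hpow : α ^ b * β ^ b = 1 := by rw [← mul_pow, h1, hb.neg_one_pow]
  have : (α - β) * ((lucasU P (c + 2 * b) - lucasU P c : ℤ) : ℝ)
      = (α - β) * ((lucasV P (c + b) * lucasU P b : ℤ) : ℝ) := by
    push_cast
    rw [mul_sub, mul_left_comm, hU, hU, hU, hV]
    linear_combination (α ^ c - β ^ c) * hpow
  exact_mod_cast mul_left_cancel₀ h0 this

theorem lucasU_add {P : ℤ} (c : ℕ) {b : ℕ} (hb : Even b) :
    lucasU P (c + 2 * b) + lucasU P c = lucasU P (c + b) * lucasV P b := by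
  obtain ⟨α, β, h1, h0, -, hU, hV⟩ := exists_binet P
  have hpow : α ^ b * β ^ b = 1 := by rw [← mul_pow, h1, hb.neg_one_pow]
  have : (α - β) * ((lucasU P (c + 2 * b) + lucasU P c : ℤ) : ℝ)
      = (α - β) * ((lucasU P (c + b) * lucasV P b : ℤ) : ℝ) := by
    push_cast
    rw [mul_add, ← mul_assoc, hU, hU, hU, hV]
    linear_combination -(α ^ c - β ^ c) * hpow
  exact_mod_cast mul_left_cancel₀ h0 this

theorem lucasV_sub {P : ℤ} (c : ℕ) {b : ℕ} (hb : Even b) :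
    lucasV P (c + 2 * b) - lucasV P c = (P ^ 2 + 4) * (lucasU P (c + b) * lucasU P b) := by
  obtain ⟨α, β, h1, -, h2, hU, hV⟩ := exists_binet P
  have hpow : α ^ b * β ^ b = 1 := by rw [← mul_pow, h1, hb.neg_one_pow]
  have : ((lucasV P (c + 2 * b) - lucasV P c : ℤ) : ℝ)
      = (((P ^ 2 + 4) * (lucasU P (c + b) * lucasU P b) : ℤ) : ℝ) := by
    push_cast
    rw [← h2, show (α - β) ^ 2 * ((lucasU P (c + b) : ℝ) * lucasU P b)
      = ((α - β) * lucasU P (c + b)) * ((α - β) * lucasU P b) by ring, hU, hU, hV, hV]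
    linear_combination (α ^ c + β ^ c) * hpow
  exact_mod_cast this

theorem lucasV_add {P : ℤ} (c : ℕ) {b : ℕ} (hb : Even b) :
    lucasV P (c + 2 * b) + lucasV P c = lucasV P (c + b) * lucasV P b := by
  obtain ⟨α, β, h1, -, -, -, hV⟩ := exists_binet P
  have hpow : α ^ b * β ^ b = 1 := by rw [← mul_pow, h1, hb.neg_one_pow]
  have : ((lucasV P (c + 2 * b) + lucasV P c : ℤ) : ℝ)
      = ((lucasV P (c + b) * lucasV P b : ℤ) : ℝ) := by
    push_cast
    rw [hV, hV, hV, hV]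
    linear_combination -(α ^ c + β ^ c) * hpow
  exact_mod_cast this

/-! ### 3-adic valuations of u and v -/

theorem lucasV_two (P : ℤ) : lucasV P 2 = P ^ 2 + 2 := by simp [lucasV]; ring

theorem sq_emod_three {P : ℤ} (hP : ¬ (3 : ℤ) ∣ P) : P ^ 2 % 3 = 1 := by
  have : P % 3 = 1 ∨ P % 3 = 2 := by omega
  rcases this with h | h <;> simp [pow_two, Int.mul_emod, h]

/-- As 3 divides v_2 = P² + 2, one has u_{m+4} ≡ -u_m (mod 3), and four initial values decide. -/
theorem three_dvd_lucasU_iff {P : ℤ} (hP : ¬ (3 : ℤ) ∣ P) (n : ℕ) :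
    (3 : ℤ) ∣ lucasU P n ↔ n % 4 = 0 := by
  have h2 := sq_emod_three hP
  induction n using Nat.strongRecOn with
  | ind n ih =>
    rcases lt_or_ge n 4 with h | h
    · interval_cases n <;> simp [lucasU]
      · exact hP
      · have : P * P = P ^ 2 := by ring
        omega
    · obtain ⟨m, rfl⟩ := Nat.exists_eq_add_of_le' h
      have := lucasU_add (P := P) m (b := 2) even_two
      have h3 : (3 : ℤ) ∣ lucasU P (m + 2) * lucasV P 2 :=
        Dvd.dvd.mul_left (by rw [lucasV_two]; omega) _
      rw [← this] at h3
      have := ih m (by omega)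
      norm_num at h3
      omega

theorem three_dvd_lucasV_iff {P : ℤ} (hP : ¬ (3 : ℤ) ∣ P) (n : ℕ) :
    (3 : ℤ) ∣ lucasV P n ↔ n % 4 = 2 := by
  have h2 := sq_emod_three hP
  have h3 : (3 : ℤ) ∣ P ^ 2 + 2 := by omega
  induction n using Nat.strongRecOn with
  | ind n ih =>
    rcases lt_or_ge n 4 with h | h
    · interval_cases n
      · simp [lucasV]
      · simpa [lucasV] using hP
      · rw [lucasV_two]; simpa using h3
      · have : lucasV P 3 = P * (P ^ 2 + 2) + P := by
          rw [show lucasV P 3 = P * (P * P + 2) + P from rfl]; ring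
        rw [this, dvd_add_right (h3.mul_left P)]
        exact iff_of_false hP (by norm_num)
    · obtain ⟨m, rfl⟩ := Nat.exists_eq_add_of_le' h
      have := lucasV_add (P := P) m (b := 2) even_two
      have h3 : (3 : ℤ) ∣ lucasV P (m + 2) * lucasV P 2 :=
        Dvd.dvd.mul_left (by rwa [lucasV_two]) _
      rw [← this] at h3
      have := ih m (by omega)
      norm_num at h3
      omega

theorem lucasU_four (P : ℤ) : lucasU P 4 = P * (P ^ 2 + 2) := by simp [lucasU]; ring

/-- From v_4 + 2 = v_2² one gets v_4 ≡ -2 modulo 3^(δ+1). The recurrence u_{4(c+2)} = v_4 u_{4(c+1)}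
- u_{4c} then has the double root -1, hence a solution linear in c up to sign. -/
theorem lucasU_four_mul_modEq {P : ℤ} {δ : ℕ} (hδ1 : 1 ≤ δ) (hδ : (3 : ℤ) ^ δ ∣ P ^ 2 + 2) (c : ℕ) :
    (3 : ℤ) ^ (δ + 1) ∣ lucasU P (4 * c) + (-1) ^ c * c * (P * (P ^ 2 + 2)) := by
  have hV4 : (3 : ℤ) ^ (δ + 1) ∣ lucasV P 4 + 2 := by
    have := lucasV_add (P := P) 0 (b := 2) even_two
    norm_num at this
    rw [show lucasV P 0 = 2 from rfl, lucasV_two] at this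
    rw [this]
    refine (pow_dvd_pow 3 (show δ + 1 ≤ δ + δ by omega)).trans ?_
    rw [pow_add]
    exact mul_dvd_mul hδ hδ
  induction c using Nat.twoStepInduction with
  | zero => simp [lucasU]
  | one => rw [show 4 * 1 = 4 from rfl, lucasU_four]; simp
  | more c ih1 ih2 =>
    have h := lucasU_add (P := P) (4 * c) (b := 4) (by decide)
    rw [show 4 * c + 4 = 4 * (c + 1) by ring] at h
    rw [show 4 * (c + 2) = 4 * c + 2 * 4 by ring]
    obtain ⟨x, hx⟩ := hV4
    obtain ⟨y, hy⟩ := ih1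
    obtain ⟨z, hz⟩ := ih2
    refine ⟨lucasU P (4 * (c + 1)) * x - 2 * z - y, ?_⟩
    push_cast at hz ⊢
    rw [pow_succ] at hz
    rw [pow_add (-1 : ℤ) c 2]
    linear_combination h + lucasU P (4 * (c + 1)) * hx - 2 * hz - hy

theorem lucasU_four_mul_three_pow {P : ℤ} (hP : ¬ (3 : ℤ) ∣ P) {δ : ℕ}
    (hδ1 : 1 ≤ δ) (hδ : (3 : ℤ) ^ δ ∣ P ^ 2 + 2) (hδ' : ¬ (3 : ℤ) ^ (δ + 1) ∣ P ^ 2 + 2)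
    {c : ℕ} (hc : ¬ 3 ∣ c) (i : ℕ) :
    (3 : ℤ) ^ (δ + i) ∣ lucasU P (4 * (3 ^ i * c)) ∧
      ¬ (3 : ℤ) ^ (δ + i + 1) ∣ lucasU P (4 * (3 ^ i * c)) := by
  induction i with
  | zero =>
    have h := lucasU_four_mul_modEq (P := P) hδ1 hδ c
    simp only [pow_zero, one_mul, add_zero]
    constructor
    · refine (dvd_add_left ?_).1 ((pow_dvd_pow 3 (Nat.le_succ δ)).trans h)
      exact (hδ.mul_left P).mul_left _
    · intro h2
      have h3 := (dvd_add_right h2).1 h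
      have hcop : IsCoprime ((3 : ℤ) ^ (δ + 1)) ((-1) ^ c * c * P) := by
        refine IsCoprime.pow_left ((Int.prime_three.coprime_iff_not_dvd).2 fun h4 ↦ ?_)
        rcases Int.prime_three.dvd_or_dvd h4 with h4 | h4
        · rcases Int.prime_three.dvd_or_dvd h4 with h4 | h4
          · exact absurd (Int.prime_three.dvd_of_dvd_pow h4) (by norm_num)
          · exact hc (by exact_mod_cast h4)
        · exact hP h4
      rw [← mul_assoc] at h3
      exact hδ' (hcop.dvd_of_dvd_mul_left h3)
  -- Tripling: u_{3b} = u_b (v_{2b} + 1) = u_b (3 + (P²+4) u_b²). As 3 ∣ u_b, the second factor is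
  -- divisible by 3 exactly once.
  | succ i ih =>
    set b := 4 * (3 ^ i * c) with hb
    have hbe : Even b := ⟨2 * (3 ^ i * c), by omega⟩
    have h1 := lucasU_sub (P := P) b hbe
    have h2 := lucasV_sub (P := P) 0 hbe
    rw [show lucasV P 0 = 2 from rfl] at h2
    simp only [zero_add] at h2
    rw [show b + 2 * b = 4 * (3 ^ (i + 1) * c) by rw [hb]; ring, show b + b = 2 * b by ring] at h1
    obtain ⟨⟨y, hy⟩, hn⟩ := ih
    have hy3 : ¬ (3 : ℤ) ∣ y := fun ⟨z, hz⟩ ↦ hn ⟨z, by rw [hy, hz]; ring⟩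
    obtain ⟨d, hd⟩ : ∃ d, δ + i = d + 1 := ⟨δ + i - 1, by omega⟩
    have key : lucasU P (4 * (3 ^ (i + 1) * c))
        = 3 ^ (δ + (i + 1)) * (y * (1 + 3 * ((P ^ 2 + 4) * (3 ^ d * y) ^ 2))) := by
      rw [show δ + (i + 1) = d + 2 by omega]
      rw [hd] at hy
      rw [hy] at h1 h2
      linear_combination h1 + (3 ^ (d + 1) * y) * h2
    rw [key]
    refine ⟨dvd_mul_right _ _, ?_⟩
    rw [pow_succ, mul_dvd_mul_iff_left (by positivity)]
    intro h
    rcases Int.prime_three.dvd_or_dvd h with h | h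
    · exact hy3 h
    · omega

theorem emultiplicity_three_lucasU {P : ℤ} (hP : ¬ (3 : ℤ) ∣ P) {δ : ℕ}
    (hδ1 : 1 ≤ δ) (hδ : (3 : ℤ) ^ δ ∣ P ^ 2 + 2) (hδ' : ¬ (3 : ℤ) ^ (δ + 1) ∣ P ^ 2 + 2)
    {b : ℕ} (hb : b % 4 = 0) :
    emultiplicity 3 (lucasU P b) = δ + emultiplicity (3 : ℤ) b := by
  obtain ⟨b, rfl⟩ := Nat.dvd_of_mod_eq_zero hb
  rcases eq_or_ne b 0 with rfl | h0
  · simp [lucasU]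
  obtain ⟨i, c, hc, rfl⟩ := Nat.exists_eq_pow_mul_and_not_dvd h0 3 (by norm_num)
  obtain ⟨h1, h2⟩ := lucasU_four_mul_three_pow hP hδ1 hδ hδ' hc i
  rw [emultiplicity_eq_coe.2 ⟨h1, h2⟩]
  have : emultiplicity (3 : ℤ) ((4 * (3 ^ i * c) : ℕ) : ℤ) = i := by
    rw [emultiplicity_eq_coe]
    push_cast
    refine ⟨⟨4 * c, by ring⟩, ?_⟩
    rw [show (4 : ℤ) * (3 ^ i * c) = 3 ^ i * (4 * c) by ring, pow_succ,
      mul_dvd_mul_iff_left (by positivity)]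
    omega
  rw [this]
  push_cast
  rfl

theorem emultiplicity_three_eq_zero {z : ℤ} (h : ¬ (3 : ℤ) ∣ z) : emultiplicity 3 z = 0 :=
  emultiplicity_eq_zero.2 h

/-- Read off from u_{2a} = v_a u_a, where u_a is prime to 3 and 4 ∣ 2a. -/
theorem emultiplicity_three_lucasV {P : ℤ} (hP : ¬ (3 : ℤ) ∣ P) {δ : ℕ}
    (hδ1 : 1 ≤ δ) (hδ : (3 : ℤ) ^ δ ∣ P ^ 2 + 2) (hδ' : ¬ (3 : ℤ) ^ (δ + 1) ∣ P ^ 2 + 2)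
    {a : ℕ} (ha : a % 4 = 2) :
    emultiplicity 3 (lucasV P a) = δ + emultiplicity (3 : ℤ) a := by
  have h := lucasU_sub (P := P) 0 (b := a) (Nat.even_iff.2 (by omega))
  rw [show lucasU P 0 = 0 from rfl, sub_zero, zero_add, zero_add] at h
  have h2 := emultiplicity_three_lucasU hP hδ1 hδ hδ' (b := 2 * a) (by omega)
  rw [h, emultiplicity_mul Int.prime_three, emultiplicity_three_eq_zero
    (z := lucasU P a) (by rw [three_dvd_lucasU_iff hP]; omega)] at h2
  push_cast at h2
  rw [emultiplicity_mul Int.prime_three, emultiplicity_three_eq_zero (z := 2) (by norm_num)] at h2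
  simpa using h2

/-! ### Classes modulo 8·3^i, squares, and lifting -/

open Finset in
theorem card_filter_range_modEq {K i : ℕ} (hi : i ≤ K) (r : ℕ) :
    #{n ∈ range (8 * 3 ^ K) | n ≡ r [MOD 8 * 3 ^ i]} = 3 ^ (K - i) := by
  have hpos : 0 < 8 * 3 ^ i := by positivity
  have hK : 8 * 3 ^ K = 8 * 3 ^ i * 3 ^ (K - i) := by
    rw [mul_assoc, ← pow_add, Nat.add_sub_cancel' hi]
  rw [← Nat.count_eq_card_filter_range, Nat.count_modEq_card _ hpos, hK,
    Nat.mul_div_cancel_left _ hpos, Nat.mul_mod_right]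
  simp

theorem coprime_eight_three_pow (i : ℕ) : Nat.Coprime 8 (3 ^ i) :=
  Nat.Coprime.pow_right i (by norm_num)

theorem modEq_eight_mul_iff {n r i : ℕ} :
    n ≡ r [MOD 8 * 3 ^ i] ↔ n % 8 = r % 8 ∧ (3 : ℤ) ^ i ∣ (n : ℤ) - r := by
  rw [← Nat.modEq_and_modEq_iff_modEq_mul (coprime_eight_three_pow i), Nat.ModEq, and_congr_right_iff]
  intro
  rw [Nat.ModEq.comm, Nat.modEq_iff_dvd]
  push_cast
  rfl

theorem exists_mod_eight_and_dvd_sub (m r i : ℕ) :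
    ∃ n, n % 8 = m % 8 ∧ (3 : ℤ) ^ i ∣ (n : ℤ) - r := by
  obtain ⟨n, h1, h2⟩ := Nat.chineseRemainder (coprime_eight_three_pow i) m r
  refine ⟨n, h1, ?_⟩
  have := h2.symm.dvd
  push_cast at this
  exact this

theorem exists_mod_eight_and_dvd_add (m i : ℕ) :
    ∃ n, n % 8 = m % 8 ∧ (3 : ℤ) ^ i ∣ (n : ℤ) + m := by
  -- Here t = 3^i - 1 plays the role of -1, so m * t is a natural representative of -m.
  obtain ⟨t, ht⟩ := Nat.exists_eq_succ_of_ne_zero (pow_ne_zero i (three_ne_zero (α := ℕ)))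
  obtain ⟨n, h1, h2⟩ := exists_mod_eight_and_dvd_sub m (m * t) i
  refine ⟨n, h1, ?_⟩
  have ht' : (3 : ℤ) ^ i = t + 1 := by exact_mod_cast ht
  rw [show (n : ℤ) + m = (n - (m * t : ℕ)) + m * 3 ^ i by rw [ht']; push_cast; ring]
  exact dvd_add h2 (dvd_mul_left _ _)

theorem three_pow_dvd_sq_iff {e n : ℕ} : 3 ^ e ∣ n ^ 2 ↔ 3 ^ ((e + 1) / 2) ∣ n := by
  rcases eq_or_ne n 0 with rfl | hn
  · simp
  rw [Nat.prime_three.pow_dvd_iff_le_factorization (pow_ne_zero 2 hn),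
    Nat.prime_three.pow_dvd_iff_le_factorization hn, Nat.factorization_pow]
  simp only [Finsupp.smul_apply, smul_eq_mul]
  omega

theorem three_pow_dvd_of_dvd_mul {j : ℕ} : ∀ {e : ℕ} {y z : ℤ}, ¬ (3 : ℤ) ^ (j + 1) ∣ y →
    (3 : ℤ) ^ e ∣ y * z → (3 : ℤ) ^ (e - j) ∣ z := by
  induction j with
  | zero =>
    intro e y z hy h
    exact Int.prime_three.pow_dvd_of_dvd_mul_left e (by simpa using hy) h
  | succ j ih =>
    intro e y z hy h
    by_cases h3 : (3 : ℤ) ∣ y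
    · obtain ⟨y, rfl⟩ := h3
      rcases e with - | e
      · simp
      · rw [pow_succ', mul_assoc, mul_dvd_mul_iff_left three_ne_zero] at h
        rw [pow_succ', mul_dvd_mul_iff_left three_ne_zero] at hy
        simpa using ih hy h
    · exact (pow_dvd_pow 3 (Nat.sub_le _ _)).trans (Int.prime_three.pow_dvd_of_dvd_mul_left e h3 h)

theorem three_pow_add_dvd_iff {δ K : ℕ} {z : ℤ} :
    (3 : ℤ) ^ (δ + K) ∣ 3 ^ (2 * δ) * z ↔ (3 : ℤ) ^ (K - δ) ∣ z := by
  rcases le_total K δ with h | h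
  · rw [Nat.sub_eq_zero_of_le h]
    simpa using (pow_dvd_pow (3 : ℤ) (show δ + K ≤ 2 * δ by omega)).mul_right z
  · rw [show δ + K = 2 * δ + (K - δ) by omega, pow_add, mul_dvd_mul_iff_left (by positivity)]

/-- If `3 ^ j` exactly divides `m`, then `3 ^ e ∣ n ^ 2 - m ^ 2` amounts to
`n ≡ ± m (mod 3 ^ (e - j))`. -/
theorem three_pow_dvd_sub_mul_add_iff {e j : ℕ} {n m : ℤ} (hj : 2 * j < e)
    (h1 : (3 : ℤ) ^ j ∣ m) (h2 : ¬ (3 : ℤ) ^ (j + 1) ∣ m) :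
    (3 : ℤ) ^ e ∣ (n - m) * (n + m) ↔ (3 : ℤ) ^ (e - j) ∣ n - m ∨ (3 : ℤ) ^ (e - j) ∣ n + m := by
  have hsplit : (3 : ℤ) ^ e = 3 ^ (e - j) * 3 ^ j := by rw [← pow_add]; congr 1; omega
  have hle : (3 : ℤ) ^ j ∣ 3 ^ (e - j) := pow_dvd_pow 3 (by omega)
  have h1' : (3 : ℤ) ^ j ∣ 2 * m := h1.mul_left 2
  constructor
  · intro h
    -- The two factors differ by 2m, so at most one of them is divisible by 3^(j+1); the other takes
    -- at most j of the e factors 3.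
    by_cases hy : (3 : ℤ) ^ (j + 1) ∣ n - m
    · left
      refine three_pow_dvd_of_dvd_mul (j := j) (y := n + m) (fun hz ↦ h2 ?_) (by rwa [mul_comm])
      have h3 : (3 : ℤ) ^ (j + 1) ∣ 2 * m := by
        have := dvd_sub hz hy
        rwa [show n + m - (n - m) = 2 * m by ring] at this
      exact (IsCoprime.pow_left (by norm_num)).dvd_of_dvd_mul_left h3
    · exact Or.inr (three_pow_dvd_of_dvd_mul hy h)
  · rintro (h | h)
    · rw [hsplit]
      refine mul_dvd_mul h ?_
      rw [show n + m = (n - m) + 2 * m by ring]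
      exact dvd_add (hle.trans h) h1'
    · rw [hsplit, mul_comm (n - m)]
      refine mul_dvd_mul h ?_
      rw [show n - m = (n + m) - 2 * m by ring]
      exact dvd_sub (hle.trans h) h1'

/-- If, on a residue class modulo `8 * 3 ^ a`, the valuation of `x n - x n'` exceeds that of
`n - n'` by the constant `c`, then `x` attains on this class every residue modulo
`3 ^ (a + c + i)` which is admissible modulo `3 ^ (a + c)`. -/
theorem exists_modEq_of_valuation {x : ℕ → ℤ} {a c r : ℕ} {b : ℤ}
    (h : ∀ k n n', n ≡ r [MOD 8 * 3 ^ a] → n' ≡ r [MOD 8 * 3 ^ a] →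
      (x n ≡ x n' [ZMOD 3 ^ k] ↔ (3 : ℤ) ^ k ∣ 3 ^ c * ((n : ℤ) - n')))
    (hb : x r ≡ b [ZMOD 3 ^ (a + c)]) (i : ℕ) :
    ∃ n, n ≡ r [MOD 8 * 3 ^ a] ∧ x n ≡ b [ZMOD 3 ^ (a + c + i)] := by
  induction i with
  | zero => exact ⟨r, rfl, hb⟩
  | succ i ih =>
    obtain ⟨n, hn, hx⟩ := ih
    have hcls (s : ℕ) : n + s * (8 * 3 ^ (a + i)) ≡ r [MOD 8 * 3 ^ a] := by
      have : s * (8 * 3 ^ (a + i)) ≡ 0 [MOD 8 * 3 ^ a] :=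
        (Nat.modEq_zero_iff_dvd).2 ⟨s * 3 ^ i, by ring⟩
      simpa using hn.add this
    have hmod (k s t : ℕ) := h k _ _ (hcls s) (hcls t)
    have hexp : (3 : ℤ) ^ (a + c + i + 1) = 3 ^ c * (3 ^ (a + i) * 3) := by ring
    have hexp' : (3 : ℤ) ^ (a + c + i) = 3 ^ c * 3 ^ (a + i) := by ring
    have hy (s : ℕ) : ∃ y, x (n + s * (8 * 3 ^ (a + i))) = b + 3 ^ (a + c + i) * y := by
      have h0 : x (n + s * (8 * 3 ^ (a + i))) ≡ x (n + 0 * (8 * 3 ^ (a + i)))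
          [ZMOD 3 ^ (a + c + i)] := by
        rw [hmod, hexp', mul_dvd_mul_iff_left (by positivity)]
        exact ⟨s * 8, by push_cast; ring⟩
      rw [zero_mul, add_zero] at h0
      obtain ⟨y, hy⟩ := ((h0.trans hx).symm).dvd
      exact ⟨y, by linear_combination hy⟩
    have hne {s t : ℕ} (hst : ¬ (3 : ℤ) ∣ (s - t) * 8) {y z : ℤ}
        (hs : x (n + s * (8 * 3 ^ (a + i))) = b + 3 ^ (a + c + i) * y)
        (ht : x (n + t * (8 * 3 ^ (a + i))) = b + 3 ^ (a + c + i) * z) : ¬ (3 : ℤ) ∣ y - z := by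
      rintro ⟨w, hw⟩
      have h1 : x (n + s * (8 * 3 ^ (a + i))) ≡ x (n + t * (8 * 3 ^ (a + i)))
          [ZMOD 3 ^ (a + c + i + 1)] := by
        refine (Int.modEq_iff_dvd.2 ?_).symm
        rw [hs, ht]
        exact ⟨w, by rw [pow_succ]; linear_combination 3 ^ (a + c + i) * hw⟩
      rw [hmod, hexp, mul_dvd_mul_iff_left (by positivity)] at h1
      push_cast at h1
      rw [show (n : ℤ) + s * (8 * 3 ^ (a + i)) - (n + t * (8 * 3 ^ (a + i)))
        = 3 ^ (a + i) * ((s - t) * 8) by ring, mul_dvd_mul_iff_left (by positivity)] at h1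
      exact hst h1
    obtain ⟨y0, h0⟩ := hy 0
    obtain ⟨y1, h1⟩ := hy 1
    obtain ⟨y2, h2⟩ := hy 2
    have h01 := hne (by norm_num) h0 h1
    have h12 := hne (by norm_num) h1 h2
    have h02 := hne (by norm_num) h0 h2
    have hfin {s : ℕ} {y : ℤ} (hs : x (n + s * (8 * 3 ^ (a + i))) = b + 3 ^ (a + c + i) * y)
        (hd : (3 : ℤ) ∣ y) :
        ∃ n, n ≡ r [MOD 8 * 3 ^ a] ∧ x n ≡ b [ZMOD 3 ^ (a + c + (i + 1))] := by
      refine ⟨_, hcls s, ?_⟩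
      obtain ⟨w, rfl⟩ := hd
      refine (Int.modEq_iff_dvd.2 ?_).symm
      rw [hs]
      exact ⟨w, by ring⟩
    -- The next ternary digits y0, y1, y2 of the three candidate lifts are pairwise distinct modulo
    -- 3, so one of them vanishes.
    have : (3 : ℤ) ∣ y0 ∨ (3 : ℤ) ∣ y1 ∨ (3 : ℤ) ∣ y2 := by omega
    rcases this with hd | hd | hd
    exacts [hfin h0 hd, hfin h1 hd, hfin h2 hd]

/-- The divisibility properties by powers of `3` shared by the sequences `u` and `v`.
The index classes are taken modulo `4`: on the class of `ρ` the valuation of `x n - x m` is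
governed by `n ^ 2 - m ^ 2`, elsewhere by `n - m`. -/
structure TernaryLaw (x : ℕ → ℤ) (δ ρ : ℕ) (β : ℤ) : Prop where
  one_le : 1 ≤ δ
  antiperiod : ∀ K n, x (n + 4 * 3 ^ K) ≡ -x n [ZMOD 3 ^ (δ + K)]
  critical : ∀ k n m : ℕ, n % 8 = m % 8 → n % 4 = ρ →
    (x n ≡ x m [ZMOD 3 ^ k] ↔ (3 : ℤ) ^ k ∣ 3 ^ (2 * δ) * (((n : ℤ) - m) * (n + m)))
  regular : ∀ k n m : ℕ, n % 8 = m % 8 → n % 4 ≠ ρ →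
    (x n ≡ x m [ZMOD 3 ^ k] ↔ (3 : ℤ) ^ k ∣ 3 ^ δ * ((n : ℤ) - m))
  three_dvd_iff : ∀ n, (3 : ℤ) ∣ x n ↔ (n + 2) % 4 = ρ
  even : Even ρ
  lt_four : ρ < 4
  card_regular : ∀ b : ℤ,
    (b ≡ 0 [ZMOD 3 ^ δ] ∨ PmModEq (3 ^ δ) b β →
      ((Finset.range 8).filter fun r ↦ r % 4 ≠ ρ ∧ x r ≡ b [ZMOD 3 ^ δ]).card = 2) ∧
    (¬ (b ≡ 0 [ZMOD 3 ^ δ] ∨ PmModEq (3 ^ δ) b β) →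
      ((Finset.range 8).filter fun r ↦ r % 4 ≠ ρ ∧ x r ≡ b [ZMOD 3 ^ δ]).card = 0)
  separated : 2 ≤ δ → ∀ n, n % 4 = ρ → ¬ (x n ≡ 0 [ZMOD 3 ^ δ] ∨ PmModEq (3 ^ δ) (x n) β)
  regular_of_eq_one : δ = 1 → ∀ b : ℤ, b ≡ 0 [ZMOD 3 ^ δ] ∨ PmModEq (3 ^ δ) b β

/-! ### Periods and counts from the ternary law -/

namespace TernaryLaw

variable {x : ℕ → ℤ} {δ ρ : ℕ} {β : ℤ}

theorem add_period (h : TernaryLaw x δ ρ β) (K n : ℕ) :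
    x (n + 8 * 3 ^ K) ≡ x n [ZMOD 3 ^ (δ + K)] := by
  have h1 := h.antiperiod K (n + 4 * 3 ^ K)
  have h2 := (h.antiperiod K n).neg
  rw [neg_neg] at h2
  rw [show n + 8 * 3 ^ K = n + 4 * 3 ^ K + 4 * 3 ^ K by ring]
  exact h1.trans h2

theorem mod_period (h : TernaryLaw x δ ρ β) (K n : ℕ) :
    x (n % (8 * 3 ^ K)) ≡ x n [ZMOD 3 ^ (δ + K)] := by
  have key (t : ℕ) : x (n % (8 * 3 ^ K) + 8 * 3 ^ K * t) ≡ x (n % (8 * 3 ^ K))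
      [ZMOD 3 ^ (δ + K)] := by
    induction t with
    | zero => simp [Int.ModEq.refl]
    | succ t ih =>
      rw [mul_add_one, ← add_assoc]
      exact (h.add_period K _).trans ih
  have := key (n / (8 * 3 ^ K))
  rw [Nat.mod_add_div] at this
  exact this.symm

theorem ne_class (h : TernaryLaw x δ ρ β) {n : ℕ} (hn : n % 4 = ρ) : ¬ (3 : ℤ) ∣ x n := by
  rw [h.three_dvd_iff]; omega

/-- Indices differing by 4 modulo 8 would have opposite values modulo 3, and values on the critical
class are prime to 3. -/
theorem mod_eight_eq (h : TernaryLaw x δ ρ β) {k n m : ℕ} (hk : 1 ≤ k) (hn : n % 4 = ρ)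
    (hm : m % 4 = ρ) (hx : x n ≡ x m [ZMOD 3 ^ k]) : n % 8 = m % 8 := by
  have h3 : x n ≡ x m [ZMOD 3] := hx.of_dvd (dvd_pow_self 3 (by omega))
  have hanti : x (n + 4) ≡ -x n [ZMOD 3] :=
    (h.antiperiod 0 n).of_dvd (dvd_pow_self 3 (by have := h.one_le; omega))
  by_contra hne
  have h4 := (h.critical 1 (n + 4) m (by omega) (by omega)).2
    (by rw [pow_one]; exact (dvd_pow_self 3 (by have := h.one_le; omega)).mul_right _)
  rw [pow_one] at h4
  have := h.ne_class hn
  have h5 := (h4.symm.trans hanti)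
  unfold Int.ModEq at h5 h3
  omega

/-- Index ρ + 2, where 3 divides x, forces 4 ∣ p; index ρ then forces 8 ∣ p; the linear law at ρ + 2
gives 3^K ∣ p. -/
theorem dvd_of_forall_modEq (h : TernaryLaw x δ ρ β) (K p : ℕ)
    (hp : ∀ n, x (n + p) ≡ x n [ZMOD 3 ^ (δ + K)]) : 8 * 3 ^ K ∣ p := by
  have hlt := h.lt_four
  obtain ⟨ρ', hρ'⟩ := h.even
  have hd : (3 : ℤ) ∣ 3 ^ (δ + K) := dvd_pow_self 3 (by have := h.one_le; omega)
  have hz : (3 : ℤ) ∣ x (ρ + 2) := (h.three_dvd_iff _).2 (by omega)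
  have hz' : (3 : ℤ) ∣ x (ρ + 2 + p) :=
    ((hp (ρ + 2)).of_dvd hd).dvd_iff.2 hz
  rw [h.three_dvd_iff] at hz'
  have h8 := h.mod_eight_eq (n := ρ + p) (m := ρ) (k := δ + K) (by have := h.one_le; omega)
    (by omega) (by omega) (hp ρ)
  have hr := (h.regular (δ + K) (ρ + 2 + p) (ρ + 2) (by omega) (by omega)).1 (hp (ρ + 2))
  rw [pow_add, mul_dvd_mul_iff_left (by positivity)] at hr
  refine (coprime_eight_three_pow K).mul_dvd_of_dvd_of_dvd (by omega) ?_
  push_cast at hr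
  rw [add_sub_cancel_left] at hr
  exact_mod_cast hr

theorem shortestPeriod_eq (h : TernaryLaw x δ ρ β) (K : ℕ) :
    shortestPeriod x (3 ^ (δ + K)) = 8 * 3 ^ K := by
  have hmem : 8 * 3 ^ K ∈ {p : ℕ | 0 < p ∧
      ∀ n : ℕ, x (n + p) ≡ x n [ZMOD ((3 ^ (δ + K) : ℕ) : ℤ)]} :=
    ⟨by positivity, fun n ↦ by push_cast; exact h.add_period K n⟩
  refine le_antisymm (Nat.sInf_le hmem) ?_
  obtain ⟨h0, h1⟩ := Nat.sInf_mem ⟨_, hmem⟩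
  exact Nat.le_of_dvd h0 (h.dvd_of_forall_modEq K _ fun n ↦ by
    have := h1 n
    push_cast at this
    exact this)

open Finset in
theorem residueFreq_eq (h : TernaryLaw x δ ρ β) (K : ℕ) (b : ℤ) :
    residueFreq x (3 ^ (δ + K)) b
      = #{n ∈ range (8 * 3 ^ K) | n % 4 = ρ ∧ x n ≡ b [ZMOD 3 ^ (δ + K)]}
        + #{n ∈ range (8 * 3 ^ K) | n % 4 ≠ ρ ∧ x n ≡ b [ZMOD 3 ^ (δ + K)]} := by
  rw [residueFreq, h.shortestPeriod_eq, ← card_filter_add_card_filter_not (fun n ↦ n % 4 = ρ),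
    filter_filter, filter_filter]
  push_cast
  simp only [and_comm, ne_eq]

open Finset in
-- Reduction modulo 8 is a bijection: the linear valuation law gives injectivity, and digit-by-digit
-- lifting gives surjectivity.
theorem card_regular_eq (h : TernaryLaw x δ ρ β) (K : ℕ) (b : ℤ) :
    #{n ∈ range (8 * 3 ^ K) | n % 4 ≠ ρ ∧ x n ≡ b [ZMOD 3 ^ (δ + K)]}
      = #{r ∈ range 8 | r % 4 ≠ ρ ∧ x r ≡ b [ZMOD 3 ^ δ]} := by
  have hle : (3 : ℤ) ^ δ ∣ 3 ^ (δ + K) := pow_dvd_pow 3 (Nat.le_add_right _ _)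
  have hmod8 (n : ℕ) : x (n % 8) ≡ x n [ZMOD 3 ^ δ] := by simpa using h.mod_period 0 n
  refine card_bij (fun n _ ↦ n % 8) ?_ ?_ ?_
  · intro n hn
    simp only [mem_filter, mem_range] at hn ⊢
    exact ⟨by omega, by omega, (hmod8 n).trans (hn.2.2.of_dvd hle)⟩
  · intro n hn m hm hnm
    simp only [mem_filter, mem_range] at hn hm
    have := (h.regular (δ + K) n m hnm hn.2.1).1 (hn.2.2.trans hm.2.2.symm)
    rw [pow_add, mul_dvd_mul_iff_left (by positivity)] at this
    exact (modEq_eight_mul_iff.2 ⟨hnm, this⟩).eq_of_lt_of_lt hn.1 hm.1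
  · intro r hr
    simp only [mem_filter, mem_range] at hr
    obtain ⟨n, hn, hx⟩ := exists_modEq_of_valuation (x := x) (a := 0) (c := δ) (r := r) (b := b)
      (fun k n n' hn hn' ↦ by
        simp only [pow_zero, mul_one, Nat.ModEq] at hn hn'
        exact h.regular k n n' (by omega) (by omega)) (by simpa using hr.2.2) K
    rw [zero_add] at hx
    simp only [pow_zero, mul_one, Nat.ModEq] at hn
    have h8 : n % (8 * 3 ^ K) % 8 = n % 8 := Nat.mod_mod_of_dvd n (dvd_mul_right _ _)
    refine ⟨n % (8 * 3 ^ K), ?_, by omega⟩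
    simp only [mem_filter, mem_range]
    exact ⟨Nat.mod_lt _ (by positivity), by omega, (h.mod_period K n).trans hx⟩

theorem critical_modEq_iff (h : TernaryLaw x δ ρ β) {K n m : ℕ} (hm : m % 4 = ρ) :
    (n % 4 = ρ ∧ x n ≡ x m [ZMOD 3 ^ (δ + K)]) ↔
      n % 8 = m % 8 ∧ (3 : ℤ) ^ (K - δ) ∣ ((n : ℤ) - m) * (n + m) := by
  constructor
  · rintro ⟨hn, hx⟩
    have h8 := h.mod_eight_eq (by have := h.one_le; omega) hn hm hx
    exact ⟨h8, three_pow_add_dvd_iff.1 ((h.critical _ n m h8 hn).1 hx)⟩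
  · rintro ⟨h8, hd⟩
    have hn : n % 4 = ρ := by omega
    exact ⟨hn, (h.critical _ n m h8 hn).2 (three_pow_add_dvd_iff.2 hd)⟩

open Finset in
theorem card_critical_of_dvd_sq (h : TernaryLaw x δ ρ β) {K m : ℕ} {b : ℤ} (hm : m % 4 = ρ)
    (hd : 3 ^ (K - δ) ∣ m ^ 2) (hx : x m ≡ b [ZMOD 3 ^ (δ + K)]) :
    #{n ∈ range (8 * 3 ^ K) | n % 4 = ρ ∧ x n ≡ b [ZMOD 3 ^ (δ + K)]}
      = 3 ^ (K - (K - δ + 1) / 2) := by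
  obtain ⟨r, hr8, hr⟩ := exists_mod_eight_and_dvd_sub m 0 ((K - δ + 1) / 2)
  rw [← card_filter_range_modEq (r := r) (by have := h.one_le; omega)]
  congr 1
  ext n
  simp only [mem_filter, mem_range, and_congr_right_iff]
  intro _
  have hxi : x n ≡ b [ZMOD 3 ^ (δ + K)] ↔ x n ≡ x m [ZMOD 3 ^ (δ + K)] :=
    ⟨fun h ↦ h.trans hx.symm, fun h ↦ h.trans hx⟩
  rw [hxi, h.critical_modEq_iff hm, modEq_eight_mul_iff, hr8, and_congr_right_iff]
  intro _
  have hd' : (3 : ℤ) ^ (K - δ) ∣ (m : ℤ) ^ 2 := by exact_mod_cast hd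
  rw [Nat.cast_zero, sub_zero] at hr
  rw [show ((n : ℤ) - m) * (n + m) = n ^ 2 - m ^ 2 by ring, dvd_sub_left hd', dvd_sub_left hr]
  exact_mod_cast three_pow_dvd_sq_iff

open Finset in
theorem card_critical_of_pow_dvd (h : TernaryLaw x δ ρ β) {K j m : ℕ} {b : ℤ} (hm : m % 4 = ρ)
    (hj : 2 * j < K - δ) (h1 : 3 ^ j ∣ m) (h2 : ¬ 3 ^ (j + 1) ∣ m)
    (hx : x m ≡ b [ZMOD 3 ^ (δ + K)]) :
    #{n ∈ range (8 * 3 ^ K) | n % 4 = ρ ∧ x n ≡ b [ZMOD 3 ^ (δ + K)]} = 2 * 3 ^ (δ + j) := by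
  set e := K - δ with he
  obtain ⟨r, hr8, hr⟩ := exists_mod_eight_and_dvd_add m (e - j)
  have h1' : (3 : ℤ) ^ j ∣ m := by exact_mod_cast h1
  have h2' : ¬ (3 : ℤ) ^ (j + 1) ∣ m := by exact_mod_cast h2
  have hset : ((range (8 * 3 ^ K)).filter fun n ↦ n % 4 = ρ ∧ x n ≡ b [ZMOD 3 ^ (δ + K)])
      = (range (8 * 3 ^ K)).filter fun n ↦
        n ≡ m [MOD 8 * 3 ^ (e - j)] ∨ n ≡ r [MOD 8 * 3 ^ (e - j)] := by
    ext n
    simp only [mem_filter, mem_range, and_congr_right_iff]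
    intro _
    have hxi : x n ≡ b [ZMOD 3 ^ (δ + K)] ↔ x n ≡ x m [ZMOD 3 ^ (δ + K)] :=
      ⟨fun h ↦ h.trans hx.symm, fun h ↦ h.trans hx⟩
    have hrn : (3 : ℤ) ^ (e - j) ∣ (n : ℤ) - r ↔ (3 : ℤ) ^ (e - j) ∣ (n : ℤ) + m := by
      rw [show (n : ℤ) + m = (n - r) + (r + m) by ring, dvd_add_left hr]
    rw [hxi, h.critical_modEq_iff hm, modEq_eight_mul_iff, modEq_eight_mul_iff, hr8,
      three_pow_dvd_sub_mul_add_iff hj h1' h2', hrn]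
    tauto
  have hle : e - j ≤ K := by omega
  rw [hset, filter_or, card_union_of_disjoint, card_filter_range_modEq hle,
    card_filter_range_modEq hle, show K - (e - j) = δ + j by omega, two_mul]
  -- A common element of the classes of m and -m would give 3^(e-j) ∣ 2m, although j + 1 ≤ e - j and
  -- 3^(j+1) does not divide m.
  rw [disjoint_filter]
  intro n _ hn hn'
  rw [modEq_eight_mul_iff] at hn hn'
  apply h2'
  have h3 : (3 : ℤ) ^ (e - j) ∣ 2 * m := by
    have := dvd_sub (dvd_add hn'.2 hr) hn.2
    rwa [show (n : ℤ) - r + (r + m) - (n - m) = 2 * m by ring] at this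
  have h4 : (3 : ℤ) ^ (e - j) ∣ m := (IsCoprime.pow_left (by norm_num)).dvd_of_dvd_mul_left h3
  exact (pow_dvd_pow 3 (by omega)).trans h4

open Finset in
-- The references `r₀` and `r j` exhaust the critical values up to sign: each critical n either has
-- a square divisible by 3^(K-δ), or an exact power 3^j with 2j < K - δ.
theorem card_critical_eq_zero (h : TernaryLaw x δ ρ β) {K : ℕ} {b : ℤ} {r₀ : ℕ} {r : ℕ → ℕ}
    (hr₀ : r₀ % 4 = ρ) (hd₀ : 3 ^ (K - δ) ∣ r₀ ^ 2) (hr : ∀ j, r j % 4 = ρ)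
    (h1 : ∀ j, 3 ^ j ∣ r j) (h2 : ∀ j, ¬ 3 ^ (j + 1) ∣ r j)
    (hb₀ : ¬ PmModEq (3 ^ (δ + K)) b (x r₀))
    (hb : ∀ j, 2 * j < K - δ → ¬ PmModEq (3 ^ (2 * (δ + j) + 1)) b (x (r j))) :
    #{n ∈ range (8 * 3 ^ K) | n % 4 = ρ ∧ x n ≡ b [ZMOD 3 ^ (δ + K)]} = 0 := by
  rw [card_eq_zero, filter_eq_empty_iff]
  rintro n - ⟨hn, hx⟩
  unfold PmModEq at hb₀ hb
  push_cast at hb₀ hb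
  have hanti := (h.antiperiod K n)
  have hodd : 3 ^ K % 2 = 1 := Nat.odd_iff.1 (Odd.pow (by decide))
  have hKdvd {i : ℕ} (hi : i ≤ K) : 3 ^ i ∣ 4 * 3 ^ K := (pow_dvd_pow 3 hi).mul_left 4
  by_cases hdeep : 3 ^ (K - δ) ∣ n ^ 2
  · have key {n' : ℕ} (h8 : n' % 8 = r₀ % 8) (hd' : 3 ^ (K - δ) ∣ n' ^ 2) :
        x n' ≡ x r₀ [ZMOD 3 ^ (δ + K)] := by
      refine ((h.critical_modEq_iff hr₀).2 ⟨h8, ?_⟩).2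
      rw [show ((n' : ℤ) - r₀) * (n' + r₀) = n' ^ 2 - r₀ ^ 2 by ring]
      exact dvd_sub (by exact_mod_cast hd') (by exact_mod_cast hd₀)
    by_cases h8 : n % 8 = r₀ % 8
    · exact hb₀ (Or.inl (hx.symm.trans (key h8 hdeep)))
    · refine hb₀ (Or.inr (hx.symm.trans ?_))
      -- The shift moves n into the class of r₀ modulo 8 at the cost of a sign, and preserves the
      -- required divisibility.
      have := key (n' := n + 4 * 3 ^ K) (by omega) (by
        rw [three_pow_dvd_sq_iff] at hdeep ⊢
        exact dvd_add hdeep (hKdvd (by omega)))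
      simpa using (hanti.symm.trans this).neg
  · have hn0 : n ≠ 0 := by rintro rfl; simp at hdeep
    obtain ⟨j, w, hw, hnw⟩ := Nat.exists_eq_pow_mul_and_not_dvd hn0 3 (by norm_num)
    have hj : 2 * j < K - δ := by
      by_contra hle
      exact hdeep (hnw ▸ ⟨3 ^ (2 * j - (K - δ)) * w ^ 2, by
        rw [mul_pow, ← mul_assoc, ← pow_add, ← pow_mul]; congr 2; omega⟩)
    have hjn : 3 ^ j ∣ n := ⟨w, hnw⟩
    have hjn' : ¬ 3 ^ (j + 1) ∣ n := by
      rw [hnw, pow_succ, mul_dvd_mul_iff_left (by positivity)]; exact hw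
    have key {n' : ℕ} (h8 : n' % 8 = r j % 8) (hd : 3 ^ j ∣ n') (hd' : ¬ 3 ^ (j + 1) ∣ n') :
        x n' ≡ x (r j) [ZMOD 3 ^ (2 * (δ + j) + 1)] := by
      refine (h.critical _ n' (r j) h8 (by have := hr j; omega)).2 ?_
      obtain ⟨y, rfl⟩ := hd
      obtain ⟨z, hz⟩ := h1 j
      have hz' := h2 j
      rw [hz, pow_succ, mul_dvd_mul_iff_left (by positivity)] at hz'
      rw [pow_succ, mul_dvd_mul_iff_left (by positivity)] at hd'
      rw [hz]
      push_cast
      rw [show (3 : ℤ) ^ (2 * δ) * ((3 ^ j * y - 3 ^ j * z) * (3 ^ j * y + 3 ^ j * z))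
        = 3 ^ (2 * (δ + j)) * ((y - z) * (y + z)) by ring, pow_succ,
        mul_dvd_mul_iff_left (by positivity)]
      -- Both cofactors are prime to 3, hence equal up to sign modulo 3; this supplies the + 1 in
      -- the exponent 2(δ+j) + 1.
      have : (3 : ℤ) ∣ (y : ℤ) - z ∨ (3 : ℤ) ∣ (y : ℤ) + z := by
        have hy : y % 3 = 1 ∨ y % 3 = 2 := by omega
        have hz : z % 3 = 1 ∨ z % 3 = 2 := by omega
        clear * - hy hz
        omega
      rcases this with h | h
      exacts [h.mul_right _, h.mul_left _]
    have hle : (3 : ℤ) ^ (2 * (δ + j) + 1) ∣ 3 ^ (δ + K) := pow_dvd_pow 3 (by omega)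
    by_cases h8 : n % 8 = r j % 8
    · exact hb j hj (Or.inl ((hx.of_dvd hle).symm.trans (key h8 hjn hjn')))
    · refine hb j hj (Or.inr ((hx.of_dvd hle).symm.trans ?_))
      have := key (n' := n + 4 * 3 ^ K) (by have := hr j; omega)
        (dvd_add hjn (hKdvd (by omega)))
        (fun h ↦ hjn' ((Nat.dvd_add_left (hKdvd (by omega))).1 h))
      simpa using ((hanti.of_dvd hle).symm.trans this).neg

theorem exists_critical_of_pm (h : TernaryLaw x δ ρ β) {K r e : ℕ} {b : ℤ} (hr : r % 4 = ρ)
    (he : e ≤ K) (hd : 3 ^ e ∣ r ^ 2) (hb : PmModEq (3 ^ (δ + K)) b (x r)) :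
    ∃ m, m % 4 = ρ ∧ 3 ^ e ∣ m ^ 2 ∧ x m ≡ b [ZMOD 3 ^ (δ + K)] := by
  unfold PmModEq at hb
  push_cast at hb
  rcases hb with hb | hb
  · exact ⟨r, hr, hd, hb.symm⟩
  · refine ⟨r + 4 * 3 ^ K, by omega, ?_, (h.antiperiod K r).trans hb.symm⟩
    rw [three_pow_dvd_sq_iff] at hd ⊢
    exact dvd_add hd ((pow_dvd_pow 3 (by omega)).mul_left 4)

theorem exists_critical_of_pm_of_pow_dvd (h : TernaryLaw x δ ρ β) {K j r : ℕ} {b : ℤ}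
    (hr : r % 4 = ρ) (hj : 2 * j < K - δ) (h1 : 3 ^ j ∣ r) (h2 : ¬ 3 ^ (j + 1) ∣ r)
    (hb : PmModEq (3 ^ (2 * (δ + j) + 1)) b (x r)) :
    ∃ m, m % 4 = ρ ∧ 3 ^ j ∣ m ∧ ¬ 3 ^ (j + 1) ∣ m ∧ x m ≡ b [ZMOD 3 ^ (δ + K)] := by
  unfold PmModEq at hb
  push_cast at hb
  have hlift {b : ℤ} (hb : b ≡ x r [ZMOD 3 ^ (2 * (δ + j) + 1)]) :
      ∃ m, m % 4 = ρ ∧ 3 ^ j ∣ m ∧ ¬ 3 ^ (j + 1) ∣ m ∧ x m ≡ b [ZMOD 3 ^ (δ + K)] := by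
    -- On the class of r modulo 8·3^(j+1) the sum n + n' has valuation exactly j, so the quadratic
    -- law becomes linear with constant 2δ + j. The starting precision is a + c = 2(δ+j) + 1.
    obtain ⟨m, hm, hx⟩ := exists_modEq_of_valuation (x := x) (a := j + 1) (c := 2 * δ + j) (r := r)
      (b := b) (fun k n n' hn hn' ↦ by
        rw [modEq_eight_mul_iff] at hn hn'
        rw [h.critical k n n' (by omega) (by omega)]
        obtain ⟨z, rfl⟩ := h1
        rw [pow_succ, mul_dvd_mul_iff_left (by positivity)] at h2
        obtain ⟨p, hp⟩ := hn.2
        obtain ⟨q, hq⟩ := hn'.2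
        have hsum : (n : ℤ) + n' = 3 ^ j * (2 * z + 3 * (p + q)) := by
          push_cast at hp hq
          rw [pow_succ] at hp hq
          linear_combination hp + hq
        rw [hsum, show (3 : ℤ) ^ (2 * δ) * (((n : ℤ) - n') * (3 ^ j * (2 * z + 3 * (p + q))))
          = (3 ^ (2 * δ + j) * ((n : ℤ) - n')) * (2 * z + 3 * (p + q)) by ring]
        have hcop : IsCoprime ((3 : ℤ) ^ k) (2 * z + 3 * (p + q)) := IsCoprime.pow_left <| by
          rw [Int.prime_three.coprime_iff_not_dvd]
          omega
        exact ⟨hcop.dvd_of_dvd_mul_right, fun hd ↦ hd.mul_right _⟩)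
      (by rw [show j + 1 + (2 * δ + j) = 2 * (δ + j) + 1 by ring]; exact hb.symm) (K - δ - 2 * j - 1)
    rw [show j + 1 + (2 * δ + j) + (K - δ - 2 * j - 1) = δ + K by omega] at hx
    rw [modEq_eight_mul_iff] at hm
    have hm2 : (3 : ℤ) ^ j ∣ (m : ℤ) - r := (pow_dvd_pow 3 (Nat.le_succ j)).trans hm.2
    refine ⟨m, by omega, ?_, fun hd ↦ h2 ?_, hx⟩
    · have h1' : (3 : ℤ) ^ j ∣ r := by exact_mod_cast h1
      exact_mod_cast (dvd_sub_left h1').1 hm2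
    · have hd' : (3 : ℤ) ^ (j + 1) ∣ m := by exact_mod_cast hd
      exact_mod_cast (dvd_sub_right hd').1 hm.2
  rcases hb with hb | hb
  · exact hlift hb
  · obtain ⟨m, hm, hd, hd', hx⟩ := hlift (b := -b) (by simpa using hb.neg)
    have hK {i : ℕ} (hi : i ≤ K) : 3 ^ i ∣ 4 * 3 ^ K := (pow_dvd_pow 3 hi).mul_left 4
    refine ⟨m + 4 * 3 ^ K, by omega, dvd_add hd (hK (by omega)),
      fun h ↦ hd' ((Nat.dvd_add_left (hK (by omega))).1 h), (h.antiperiod K m).trans ?_⟩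
    simpa using hx.neg

end TernaryLaw

/-! ### Frequencies and instability -/

namespace TernaryLaw

variable {x : ℕ → ℤ} {δ ρ : ℕ} {β : ℤ}

/-- The number of indices `n ≡ ρ (mod 4)` in a period modulo `3 ^ (δ + K)` with
`x n ≡ b (mod 3 ^ (δ + K))`. -/
def criticalFreq (x : ℕ → ℤ) (δ ρ K : ℕ) (b : ℤ) : ℕ :=
  ((Finset.range (8 * 3 ^ K)).filter fun n ↦ n % 4 = ρ ∧ x n ≡ b [ZMOD 3 ^ (δ + K)]).card

theorem residueFreq_of_regular (h : TernaryLaw x δ ρ β) (K : ℕ) {b : ℤ}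
    (hb : b ≡ 0 [ZMOD 3 ^ δ] ∨ PmModEq (3 ^ δ) b β) :
    residueFreq x (3 ^ (δ + K)) b = criticalFreq x δ ρ K b + 2 := by
  rw [h.residueFreq_eq, h.card_regular_eq, (h.card_regular b).1 hb, criticalFreq]

theorem residueFreq_of_not_regular (h : TernaryLaw x δ ρ β) (K : ℕ) {b : ℤ}
    (hb : ¬ (b ≡ 0 [ZMOD 3 ^ δ] ∨ PmModEq (3 ^ δ) b β)) :
    residueFreq x (3 ^ (δ + K)) b = criticalFreq x δ ρ K b := by
  rw [h.residueFreq_eq, h.card_regular_eq, (h.card_regular b).2 hb, criticalFreq, add_zero]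

theorem criticalFreq_eq_zero_of_regular (h : TernaryLaw x δ ρ β) (hδ : 2 ≤ δ) (K : ℕ) {b : ℤ}
    (hb : b ≡ 0 [ZMOD 3 ^ δ] ∨ PmModEq (3 ^ δ) b β) : criticalFreq x δ ρ K b = 0 := by
  rw [criticalFreq, Finset.card_eq_zero, Finset.filter_eq_empty_iff]
  rintro n - ⟨hn, hx⟩
  have hx' : x n ≡ b [ZMOD 3 ^ δ] := hx.of_dvd (pow_dvd_pow 3 (Nat.le_add_right _ _))
  refine h.separated hδ n hn ?_
  unfold PmModEq at hb ⊢
  push_cast at hb ⊢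
  exact hb.imp hx'.trans (Or.imp hx'.trans hx'.trans)

theorem criticalFreq_of_pm (h : TernaryLaw x δ ρ β) {K r₀ : ℕ} (hr₀ : r₀ % 4 = ρ)
    (hd₀ : 3 ^ (K - δ) ∣ r₀ ^ 2) {b : ℤ} (hb : PmModEq (3 ^ (δ + K)) b (x r₀)) :
    criticalFreq x δ ρ K b = 3 ^ (K - (K - δ + 1) / 2) := by
  obtain ⟨m, hm, hd, hx⟩ := h.exists_critical_of_pm hr₀ (Nat.sub_le _ _) hd₀ hb
  exact h.card_critical_of_dvd_sq hm hd hx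

theorem criticalFreq_of_pm_of_pow_dvd (h : TernaryLaw x δ ρ β) {K l : ℕ} {r : ℕ → ℕ}
    (hr : ∀ j, r j % 4 = ρ) (h1 : ∀ j, 3 ^ j ∣ r j) (h2 : ∀ j, ¬ 3 ^ (j + 1) ∣ r j)
    (hl : δ ≤ l) (hl' : l ≤ (δ + K - 1) / 2) {b : ℤ}
    (hb : PmModEq (3 ^ (2 * l + 1)) b (x (r (l - δ)))) :
    criticalFreq x δ ρ K b = 2 * 3 ^ l := by
  obtain ⟨j, rfl⟩ := Nat.exists_eq_add_of_le hl
  rw [Nat.add_sub_cancel_left] at hb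
  have hpos := h.one_le
  have hj : 2 * j < K - δ := by omega
  obtain ⟨m, hm, hd, hd', hx⟩ := h.exists_critical_of_pm_of_pow_dvd (hr j) hj (h1 j) (h2 j) hb
  exact h.card_critical_of_pow_dvd hm hj hd hd' hx

theorem criticalFreq_eq_zero (h : TernaryLaw x δ ρ β) {K r₀ : ℕ} {r : ℕ → ℕ} (hr₀ : r₀ % 4 = ρ)
    (hd₀ : 3 ^ (K - δ) ∣ r₀ ^ 2)
    (hr : ∀ j, r j % 4 = ρ) (h1 : ∀ j, 3 ^ j ∣ r j) (h2 : ∀ j, ¬ 3 ^ (j + 1) ∣ r j) {b : ℤ}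
    (hb₀ : ¬ PmModEq (3 ^ (δ + K)) b (x r₀))
    (hb : ¬ ∃ l, δ ≤ l ∧ l ≤ (δ + K - 1) / 2 ∧ PmModEq (3 ^ (2 * l + 1)) b (x (r (l - δ)))) :
    criticalFreq x δ ρ K b = 0 := by
  refine h.card_critical_eq_zero hr₀ hd₀ hr h1 h2 hb₀ fun j hj hbj ↦ hb ⟨δ + j, ?_, ?_, ?_⟩
  · omega
  · omega
  · rwa [Nat.add_sub_cancel_left]

theorem residueFreq_of_eq_one (h : TernaryLaw x δ ρ β) (hδ : δ = 1) {K r₀ : ℕ} {r : ℕ → ℕ}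
    (hr₀ : r₀ % 4 = ρ) (hd₀ : 3 ^ (K - δ) ∣ r₀ ^ 2)
    (hr : ∀ j, r j % 4 = ρ) (h1 : ∀ j, 3 ^ j ∣ r j) (h2 : ∀ j, ¬ 3 ^ (j + 1) ∣ r j) (b : ℤ) :
    (PmModEq (3 ^ (δ + K)) b (x r₀) → residueFreq x (3 ^ (δ + K)) b = 3 ^ ((δ + K) / 2) + 2) ∧
    (∀ l : ℕ, δ ≤ l → l ≤ (δ + K - 1) / 2 → PmModEq (3 ^ (2 * l + 1)) b (x (r (l - δ))) →
      residueFreq x (3 ^ (δ + K)) b = 2 * 3 ^ l + 2) ∧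
    (¬ PmModEq (3 ^ (δ + K)) b (x r₀) →
      (¬ ∃ l : ℕ, δ ≤ l ∧ l ≤ (δ + K - 1) / 2 ∧ PmModEq (3 ^ (2 * l + 1)) b (x (r (l - δ)))) →
      residueFreq x (3 ^ (δ + K)) b = 2) := by
  rw [h.residueFreq_of_regular K (h.regular_of_eq_one hδ b)]
  refine ⟨fun hb ↦ ?_, fun l hl hl' hb ↦ ?_, fun hb₀ hb ↦ ?_⟩
  · rw [h.criticalFreq_of_pm hr₀ hd₀ hb]
    congr 2
    omega
  · rw [h.criticalFreq_of_pm_of_pow_dvd hr h1 h2 hl hl' hb]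
  · rw [h.criticalFreq_eq_zero hr₀ hd₀ hr h1 h2 hb₀ hb]

theorem residueFreq_of_criticalFreq_ne_zero (h : TernaryLaw x δ ρ β) (hδ : 2 ≤ δ) {K : ℕ} {b : ℤ}
    (hb : criticalFreq x δ ρ K b ≠ 0) :
    residueFreq x (3 ^ (δ + K)) b = criticalFreq x δ ρ K b :=
  h.residueFreq_of_not_regular K fun hreg ↦ hb (h.criticalFreq_eq_zero_of_regular hδ K hreg)

theorem residueFreq_of_regular_of_two_le (h : TernaryLaw x δ ρ β) (hδ : 2 ≤ δ) (K : ℕ) {b : ℤ}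
    (hb : b ≡ 0 [ZMOD 3 ^ δ] ∨ PmModEq (3 ^ δ) b β) :
    residueFreq x (3 ^ (δ + K)) b = 2 := by
  rw [h.residueFreq_of_regular K hb, h.criticalFreq_eq_zero_of_regular hδ K hb]

theorem residueFreq_of_two_le (h : TernaryLaw x δ ρ β) (hδ : 2 ≤ δ) {K r₀ : ℕ} {r : ℕ → ℕ}
    (hK : 2 * δ - 1 ≤ δ + K) (hr₀ : r₀ % 4 = ρ) (hd₀ : 3 ^ (K - δ) ∣ r₀ ^ 2)
    (hr : ∀ j, r j % 4 = ρ) (h1 : ∀ j, 3 ^ j ∣ r j) (h2 : ∀ j, ¬ 3 ^ (j + 1) ∣ r j) (b : ℤ) :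
    (PmModEq (3 ^ (δ + K)) b (x r₀) → residueFreq x (3 ^ (δ + K)) b = 3 ^ ((δ + K) / 2)) ∧
    (∀ l : ℕ, δ ≤ l → l ≤ (δ + K - 1) / 2 → PmModEq (3 ^ (2 * l + 1)) b (x (r (l - δ))) →
      residueFreq x (3 ^ (δ + K)) b = 2 * 3 ^ l) ∧
    (b ≡ 0 [ZMOD 3 ^ δ] ∨ PmModEq (3 ^ δ) b β → residueFreq x (3 ^ (δ + K)) b = 2) ∧
    (¬ PmModEq (3 ^ (δ + K)) b (x r₀) →
      (¬ ∃ l : ℕ, δ ≤ l ∧ l ≤ (δ + K - 1) / 2 ∧ PmModEq (3 ^ (2 * l + 1)) b (x (r (l - δ)))) →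
      ¬ (b ≡ 0 [ZMOD 3 ^ δ] ∨ PmModEq (3 ^ δ) b β) →
      residueFreq x (3 ^ (δ + K)) b = 0) := by
  refine ⟨fun hb ↦ ?_, fun l hl hl' hb ↦ ?_, h.residueFreq_of_regular_of_two_le hδ K,
    fun hb₀ hb hreg ↦ ?_⟩
  · have := h.criticalFreq_of_pm hr₀ hd₀ hb
    rw [h.residueFreq_of_criticalFreq_ne_zero hδ (by rw [this]; positivity), this]
    -- The hypothesis gives K ≥ δ - 1, which is what makes K - ⌈(K-δ)/2⌉ equal to ⌊(δ+K)/2⌋,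
    -- including K = δ - 1, where the subtraction truncates.
    congr 1
    omega
  · have := h.criticalFreq_of_pm_of_pow_dvd hr h1 h2 hl hl' hb
    rw [h.residueFreq_of_criticalFreq_ne_zero hδ (by rw [this]; positivity), this]
  · rw [h.residueFreq_of_not_regular K hreg, h.criticalFreq_eq_zero hr₀ hd₀ hr h1 h2 hb₀ hb]

/-- Here K < δ, so the quadratic condition is empty: x is constant up to sign on the critical class,
and each sign takes all 3^K indices of one class modulo 8. -/
theorem residueFreq_of_lt (h : TernaryLaw x δ ρ β) (hδ : 2 ≤ δ) {K r₀ : ℕ} {r : ℕ → ℕ}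
    (hK : δ + K < 2 * δ - 1) (hr₀ : r₀ % 4 = ρ)
    (hr : ∀ j, r j % 4 = ρ) (h1 : ∀ j, 3 ^ j ∣ r j) (h2 : ∀ j, ¬ 3 ^ (j + 1) ∣ r j) (b : ℤ) :
    (PmModEq (3 ^ (δ + K)) b (x r₀) → residueFreq x (3 ^ (δ + K)) b = 3 ^ (δ + K - δ)) ∧
    (b ≡ 0 [ZMOD 3 ^ δ] ∨ PmModEq (3 ^ δ) b β → residueFreq x (3 ^ (δ + K)) b = 2) ∧
    (¬ PmModEq (3 ^ (δ + K)) b (x r₀) → ¬ (b ≡ 0 [ZMOD 3 ^ δ] ∨ PmModEq (3 ^ δ) b β) →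
      residueFreq x (3 ^ (δ + K)) b = 0) := by
  have hd₀ : 3 ^ (K - δ) ∣ r₀ ^ 2 := by rw [Nat.sub_eq_zero_of_le (by omega)]; simp
  refine ⟨fun hb ↦ ?_, h.residueFreq_of_regular_of_two_le hδ K, fun hb₀ hreg ↦ ?_⟩
  · have := h.criticalFreq_of_pm hr₀ hd₀ hb
    rw [h.residueFreq_of_criticalFreq_ne_zero hδ (by rw [this]; positivity), this]
    congr 1
    omega
  · rw [h.residueFreq_of_not_regular K hreg, h.criticalFreq_eq_zero hr₀ hd₀ hr h1 h2 hb₀]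
    rintro ⟨l, hl, hl', -⟩
    omega

theorem not_isStableMod (h : TernaryLaw x δ ρ β) : ¬ IsStableMod x 3 := by
  rintro ⟨k, -, hk⟩
  set B := shortestPeriod x (3 ^ k) with hB
  -- This K makes the critical frequency at least 3^B, while no frequency modulo 3^k exceeds the
  -- period B.
  set K := 2 * B + δ + k with hK
  have hset := hk (δ + K) (by omega)
  have hodd : 3 ^ K % 2 = 1 := Nat.odd_iff.1 (Odd.pow (by decide))
  obtain ⟨ρ', hρ'⟩ := h.even
  have hlt := h.lt_four
  have hr₀ : ρ * 3 ^ K % 4 = ρ := by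
    have : ρ' = 0 ∨ ρ' = 1 := by omega
    rcases this with rfl | rfl <;> subst hρ' <;> omega
  set b := x (ρ * 3 ^ K) with hb
  have hfreq := h.criticalFreq_of_pm (K := K) (b := b) hr₀
    (by rw [three_pow_dvd_sq_iff]; exact (pow_dvd_pow 3 (by omega)).mul_left ρ)
    (Or.inl (Int.ModEq.refl _))
  have hmem : residueFreq x (3 ^ (δ + K)) b ∈ freqSet x (3 ^ (δ + K)) := by
    have hpos : (0 : ℤ) < ((3 ^ (δ + K) : ℕ) : ℤ) := by positivity
    have h0 := Int.emod_nonneg b hpos.ne'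
    refine ⟨(b % ((3 ^ (δ + K) : ℕ) : ℤ)).toNat, ?_, ?_⟩
    · have := Int.emod_lt_of_pos b hpos
      omega
    · rw [Int.toNat_of_nonneg h0]
      unfold residueFreq
      congr 1
      ext n
      simp [Int.ModEq]
  rw [hset] at hmem
  obtain ⟨r, -, hr⟩ := hmem
  have hle : residueFreq x (3 ^ k) r ≤ B := by
    simpa [residueFreq] using Finset.card_filter_le (Finset.range B) _
  have hge : 3 ^ B ≤ residueFreq x (3 ^ (δ + K)) b := by
    have h3 : 3 ^ B ≤ 3 ^ (K - (K - δ + 1) / 2) := Nat.pow_le_pow_right (by norm_num) (by omega)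
    by_cases hreg : b ≡ 0 [ZMOD 3 ^ δ] ∨ PmModEq (3 ^ δ) b β
    · rw [h.residueFreq_of_regular K hreg]; omega
    · rw [h.residueFreq_of_not_regular K hreg]; omega
  have := Nat.lt_pow_self (n := B) (show 1 < 3 by norm_num)
  omega

end TernaryLaw

/-! ### The ternary law for u and v -/

theorem three_pow_dvd_iff_of_emultiplicity_eq {y z : ℤ} (h : emultiplicity 3 y = emultiplicity 3 z)
    (k : ℕ) : (3 : ℤ) ^ k ∣ y ↔ (3 : ℤ) ^ k ∣ z := by
  rw [pow_dvd_iff_le_emultiplicity, pow_dvd_iff_le_emultiplicity, h]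

/-- The difference formulas need the larger index written as the smaller plus 2b; antisymmetry of f
removes the order, and congruence modulo 8 gives 4 ∣ b. -/
theorem modEq_iff_of_symm {x : ℕ → ℤ} {C : ℕ → Prop} {f : ℕ → ℕ → ℤ} (hf : ∀ n m, f m n = -f n m)
    (h : ∀ n b, C n → 4 ∣ b →
      emultiplicity 3 (x (n + 2 * b) - x n) = emultiplicity 3 (f (n + 2 * b) n))
    {n m : ℕ} (k : ℕ) (hn : C n) (hm : C m) (h8 : n % 8 = m % 8) :
    x n ≡ x m [ZMOD 3 ^ k] ↔ (3 : ℤ) ^ k ∣ f n m := by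
  have key {n m : ℕ} (hm : C m) (h8 : n % 8 = m % 8) (hle : m ≤ n) :
      x m ≡ x n [ZMOD 3 ^ k] ↔ (3 : ℤ) ^ k ∣ f n m := by
    obtain ⟨b, rfl⟩ : ∃ b, n = m + 2 * b := ⟨(n - m) / 2, by omega⟩
    rw [Int.modEq_iff_dvd]
    exact three_pow_dvd_iff_of_emultiplicity_eq (h m b hm (by omega)) k
  rcases le_total m n with hle | hle
  · rw [← key hm h8 hle]
    exact ⟨Int.ModEq.symm, Int.ModEq.symm⟩
  · rw [key hn h8.symm hle, hf, dvd_neg]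

theorem emultiplicity_three_pow (i : ℕ) : emultiplicity (3 : ℤ) (3 ^ i) = i :=
  emultiplicity_pow_self_of_prime Int.prime_three i

theorem emultiplicity_three_two_mul (z : ℤ) : emultiplicity 3 (2 * z) = emultiplicity 3 z := by
  rw [emultiplicity_mul Int.prime_three, emultiplicity_three_eq_zero (by norm_num), zero_add]

theorem emultiplicity_three_regular (δ n b : ℕ) :
    emultiplicity (3 : ℤ) (3 ^ δ * (((n + 2 * b : ℕ) : ℤ) - n)) = δ + emultiplicity (3 : ℤ) b := by
  rw [show (((n + 2 * b : ℕ) : ℤ) - n) = 2 * b by push_cast; ring,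
    emultiplicity_mul Int.prime_three, emultiplicity_three_pow, emultiplicity_three_two_mul]

theorem emultiplicity_three_critical (δ n b : ℕ) :
    emultiplicity (3 : ℤ) (3 ^ (2 * δ) * ((((n + 2 * b : ℕ) : ℤ) - n) * ((n + 2 * b : ℕ) + n)))
      = (δ + emultiplicity (3 : ℤ) ((n + b : ℕ) : ℤ)) + (δ + emultiplicity (3 : ℤ) b) := by
  rw [show (((n + 2 * b : ℕ) : ℤ) - n) * ((n + 2 * b : ℕ) + n)
    = (2 * b) * (2 * (n + b : ℕ)) by push_cast; ring, two_mul δ, pow_add,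
    emultiplicity_mul Int.prime_three, emultiplicity_mul Int.prime_three,
    emultiplicity_mul Int.prime_three, emultiplicity_three_pow, emultiplicity_three_two_mul,
    emultiplicity_three_two_mul]
  ring

theorem modEq_or_modEq_neg_of_antiperiod {x : ℕ → ℤ} {M : ℤ}
    (h : ∀ n, x (n + 4) ≡ -x n [ZMOD M]) (n : ℕ) :
    x n ≡ x (n % 4) [ZMOD M] ∨ x n ≡ -x (n % 4) [ZMOD M] := by
  induction n using Nat.strongRecOn with
  | ind n ih =>
    rcases lt_or_ge n 4 with hn | hn
    · rw [Nat.mod_eq_of_lt hn]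
      exact Or.inl rfl
    · obtain ⟨m, rfl⟩ := Nat.exists_eq_add_of_le' hn
      rw [Nat.add_mod_right]
      rcases ih m (by omega) with h1 | h1
      · exact Or.inr ((h m).trans h1.neg)
      · exact Or.inl (by simpa using (h m).trans h1.neg)

section

variable {P : ℤ} {δ : ℕ}

theorem three_pow_dvd_lucasV (hP : ¬ (3 : ℤ) ∣ P) (hδ1 : 1 ≤ δ) (hδ : (3 : ℤ) ^ δ ∣ P ^ 2 + 2)
    (hδ' : ¬ (3 : ℤ) ^ (δ + 1) ∣ P ^ 2 + 2) (K : ℕ) :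
    (3 : ℤ) ^ (δ + K) ∣ lucasV P (2 * 3 ^ K) := by
  have hodd : 3 ^ K % 2 = 1 := Nat.odd_iff.1 (Odd.pow (by decide))
  rw [pow_dvd_iff_le_emultiplicity, emultiplicity_three_lucasV hP hδ1 hδ hδ' (by omega)]
  push_cast
  rw [emultiplicity_three_two_mul, emultiplicity_three_pow]

theorem lucasU_antiperiod (hP : ¬ (3 : ℤ) ∣ P) (hδ1 : 1 ≤ δ) (hδ : (3 : ℤ) ^ δ ∣ P ^ 2 + 2)
    (hδ' : ¬ (3 : ℤ) ^ (δ + 1) ∣ P ^ 2 + 2) (K n : ℕ) :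
    lucasU P (n + 4 * 3 ^ K) ≡ -lucasU P n [ZMOD 3 ^ (δ + K)] := by
  refine (Int.modEq_iff_dvd.2 ?_).symm
  rw [sub_neg_eq_add, show n + 4 * 3 ^ K = n + 2 * (2 * 3 ^ K) by ring,
    lucasU_add n (even_two_mul _)]
  exact (three_pow_dvd_lucasV hP hδ1 hδ hδ' K).mul_left _

theorem lucasV_antiperiod (hP : ¬ (3 : ℤ) ∣ P) (hδ1 : 1 ≤ δ) (hδ : (3 : ℤ) ^ δ ∣ P ^ 2 + 2)
    (hδ' : ¬ (3 : ℤ) ^ (δ + 1) ∣ P ^ 2 + 2) (K n : ℕ) :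
    lucasV P (n + 4 * 3 ^ K) ≡ -lucasV P n [ZMOD 3 ^ (δ + K)] := by
  refine (Int.modEq_iff_dvd.2 ?_).symm
  rw [sub_neg_eq_add, show n + 4 * 3 ^ K = n + 2 * (2 * 3 ^ K) by ring,
    lucasV_add n (even_two_mul _)]
  exact (three_pow_dvd_lucasV hP hδ1 hδ hδ' K).mul_left _

theorem emod_nine_of_dvd (hδ : (3 : ℤ) ^ δ ∣ P ^ 2 + 2) (h2 : 2 ≤ δ) : P % 9 = 4 ∨ P % 9 = 5 := by
  have h9 : (9 : ℤ) ∣ P ^ 2 + 2 := (pow_dvd_pow (3 : ℤ) h2).trans hδ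
  have hP : P % 9 = 0 ∨ P % 9 = 1 ∨ P % 9 = 2 ∨ P % 9 = 3 ∨ P % 9 = 4 ∨ P % 9 = 5 ∨ P % 9 = 6 ∨
    P % 9 = 7 ∨ P % 9 = 8 := by omega
  rw [Int.dvd_iff_emod_eq_zero, pow_two, Int.add_emod, Int.mul_emod] at h9
  rcases hP with h | h | h | h | h | h | h | h | h <;> simp [h] at h9 ⊢

open Finset in
-- At the indices 0, 1, 3, 4, 5, 7 the values modulo 3^δ are 0, 1, -1, 0, -1, 1, and 0, 1, -1 are
-- already distinct modulo 3.
theorem lucasU_card_regular (hP : ¬ (3 : ℤ) ∣ P) (hδ1 : 1 ≤ δ) (hδ : (3 : ℤ) ^ δ ∣ P ^ 2 + 2)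
    (h4 : ∀ n, lucasU P (n + 4) ≡ -lucasU P n [ZMOD 3 ^ δ]) (b : ℤ) :
    (b ≡ 0 [ZMOD 3 ^ δ] ∨ PmModEq (3 ^ δ) b 1 →
      #{r ∈ range 8 | r % 4 ≠ 2 ∧ lucasU P r ≡ b [ZMOD 3 ^ δ]} = 2) ∧
    (¬ (b ≡ 0 [ZMOD 3 ^ δ] ∨ PmModEq (3 ^ δ) b 1) →
      #{r ∈ range 8 | r % 4 ≠ 2 ∧ lucasU P r ≡ b [ZMOD 3 ^ δ]} = 0) := by
  have hd : (3 : ℤ) ∣ 3 ^ δ := dvd_pow_self 3 (by omega)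
  have e0 : lucasU P 0 ≡ 0 [ZMOD 3 ^ δ] := rfl
  have e1 : lucasU P 1 ≡ 1 [ZMOD 3 ^ δ] := rfl
  have e3 : lucasU P 3 ≡ -1 [ZMOD 3 ^ δ] := by
    refine (Int.modEq_iff_dvd.2 ?_).symm
    rw [show lucasU P 3 - -1 = P ^ 2 + 2 by simp [lucasU]; ring]
    exact hδ
  have e4 := (h4 0).trans e0.neg
  have e5 := (h4 1).trans e1.neg
  have e7 := (h4 3).trans e3.neg
  norm_num at e4 e5 e7
  unfold PmModEq
  push_cast
  constructor
  · rintro (hb | hb | hb)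
    · rw [show ({r ∈ range 8 | r % 4 ≠ 2 ∧ lucasU P r ≡ b [ZMOD 3 ^ δ]} : Finset ℕ) = {0, 4} from ?_]
      · rfl
      ext r
      simp only [mem_filter, mem_range, mem_insert, mem_singleton]
      constructor
      · rintro ⟨hr, hr4, hx⟩
        have hx3 := (hx.trans hb).of_dvd hd
        have := (three_dvd_lucasU_iff hP r).1 (Int.dvd_of_emod_eq_zero hx3)
        omega
      · rintro (rfl | rfl)
        exacts [⟨by omega, by omega, e0.trans hb.symm⟩, ⟨by omega, by omega, e4.trans hb.symm⟩]
    · rw [show ({r ∈ range 8 | r % 4 ≠ 2 ∧ lucasU P r ≡ b [ZMOD 3 ^ δ]} : Finset ℕ) = {1, 7} from ?_]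
      · rfl
      ext r
      simp only [mem_filter, mem_range, mem_insert, mem_singleton]
      constructor
      · rintro ⟨hr, hr4, hx⟩
        have hx3 := (hx.trans hb).of_dvd hd
        have e0 := e0.of_dvd hd
        have e3 := e3.of_dvd hd
        have e4 := e4.of_dvd hd
        have e5 := e5.of_dvd hd
        unfold Int.ModEq at e0 e3 e4 e5 hx3
        interval_cases r <;> omega
      · rintro (rfl | rfl)
        exacts [⟨by omega, by omega, e1.trans hb.symm⟩, ⟨by omega, by omega, e7.trans hb.symm⟩]
    · rw [show ({r ∈ range 8 | r % 4 ≠ 2 ∧ lucasU P r ≡ b [ZMOD 3 ^ δ]} : Finset ℕ) = {3, 5} from ?_]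
      · rfl
      ext r
      simp only [mem_filter, mem_range, mem_insert, mem_singleton]
      constructor
      · rintro ⟨hr, hr4, hx⟩
        have hx3 := (hx.trans hb).of_dvd hd
        have e0 := e0.of_dvd hd
        have e1 := e1.of_dvd hd
        have e4 := e4.of_dvd hd
        have e7 := e7.of_dvd hd
        unfold Int.ModEq at e0 e1 e4 e7 hx3
        interval_cases r <;> omega
      · rintro (rfl | rfl)
        exacts [⟨by omega, by omega, e3.trans hb.symm⟩, ⟨by omega, by omega, e5.trans hb.symm⟩]
  · intro hb
    rw [card_eq_zero, filter_eq_empty_iff]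
    rintro r hr ⟨hr4, hx⟩
    rw [mem_range] at hr
    apply hb
    interval_cases r
    · exact Or.inl (hx.symm.trans e0)
    · exact Or.inr (Or.inl (hx.symm.trans e1))
    · omega
    · exact Or.inr (Or.inr (hx.symm.trans e3))
    · exact Or.inl (hx.symm.trans e4)
    · exact Or.inr (Or.inr (hx.symm.trans e5))
    · omega
    · exact Or.inr (Or.inl (hx.symm.trans e7))

open Finset in
-- At the indices 1, 2, 3, 5, 6, 7 the values modulo 3^δ are P, 0, P, -P, 0, -P, separated modulo 3
-- because 3 ∤ P.
theorem lucasV_card_regular (hP : ¬ (3 : ℤ) ∣ P) (hδ1 : 1 ≤ δ) (hδ : (3 : ℤ) ^ δ ∣ P ^ 2 + 2)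
    (h4 : ∀ n, lucasV P (n + 4) ≡ -lucasV P n [ZMOD 3 ^ δ]) (b : ℤ) :
    (b ≡ 0 [ZMOD 3 ^ δ] ∨ PmModEq (3 ^ δ) b P →
      #{r ∈ range 8 | r % 4 ≠ 0 ∧ lucasV P r ≡ b [ZMOD 3 ^ δ]} = 2) ∧
    (¬ (b ≡ 0 [ZMOD 3 ^ δ] ∨ PmModEq (3 ^ δ) b P) →
      #{r ∈ range 8 | r % 4 ≠ 0 ∧ lucasV P r ≡ b [ZMOD 3 ^ δ]} = 0) := by
  have hd : (3 : ℤ) ∣ 3 ^ δ := dvd_pow_self 3 (by omega)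
  have e1 : lucasV P 1 ≡ P [ZMOD 3 ^ δ] := rfl
  have e2 : lucasV P 2 ≡ 0 [ZMOD 3 ^ δ] := by
    rw [lucasV_two]
    exact Int.modEq_zero_iff_dvd.2 hδ
  have e3 : lucasV P 3 ≡ P [ZMOD 3 ^ δ] := by
    refine (Int.modEq_iff_dvd.2 ?_).symm
    rw [show lucasV P 3 - P = P * (P ^ 2 + 2) by simp only [lucasV]; ring]
    exact hδ.mul_left P
  have e5 := (h4 1).trans e1.neg
  have e6 := (h4 2).trans e2.neg
  have e7 := (h4 3).trans e3.neg
  norm_num at e5 e6 e7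
  unfold PmModEq
  push_cast
  constructor
  · rintro (hb | hb | hb)
    · rw [show ({r ∈ range 8 | r % 4 ≠ 0 ∧ lucasV P r ≡ b [ZMOD 3 ^ δ]} : Finset ℕ) = {2, 6} from ?_]
      · rfl
      ext r
      simp only [mem_filter, mem_range, mem_insert, mem_singleton]
      constructor
      · rintro ⟨hr, hr4, hx⟩
        have hx3 := (hx.trans hb).of_dvd hd
        have := (three_dvd_lucasV_iff hP r).1 (Int.dvd_of_emod_eq_zero hx3)
        omega
      · rintro (rfl | rfl)
        exacts [⟨by omega, by omega, e2.trans hb.symm⟩, ⟨by omega, by omega, e6.trans hb.symm⟩]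
    · rw [show ({r ∈ range 8 | r % 4 ≠ 0 ∧ lucasV P r ≡ b [ZMOD 3 ^ δ]} : Finset ℕ) = {1, 3} from ?_]
      · rfl
      ext r
      simp only [mem_filter, mem_range, mem_insert, mem_singleton]
      constructor
      · rintro ⟨hr, hr4, hx⟩
        have hx3 := (hx.trans hb).of_dvd hd
        have e2 := e2.of_dvd hd
        have e5 := e5.of_dvd hd
        have e6 := e6.of_dvd hd
        have e7 := e7.of_dvd hd
        unfold Int.ModEq at e2 e5 e6 e7 hx3
        interval_cases r <;> omega
      · rintro (rfl | rfl)
        exacts [⟨by omega, by omega, e1.trans hb.symm⟩, ⟨by omega, by omega, e3.trans hb.symm⟩]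
    · rw [show ({r ∈ range 8 | r % 4 ≠ 0 ∧ lucasV P r ≡ b [ZMOD 3 ^ δ]} : Finset ℕ) = {5, 7} from ?_]
      · rfl
      ext r
      simp only [mem_filter, mem_range, mem_insert, mem_singleton]
      constructor
      · rintro ⟨hr, hr4, hx⟩
        have hx3 := (hx.trans hb).of_dvd hd
        have e1 := e1.of_dvd hd
        have e2 := e2.of_dvd hd
        have e3 := e3.of_dvd hd
        have e6 := e6.of_dvd hd
        unfold Int.ModEq at e1 e2 e3 e6 hx3
        interval_cases r <;> omega
      · rintro (rfl | rfl)
        exacts [⟨by omega, by omega, e5.trans hb.symm⟩, ⟨by omega, by omega, e7.trans hb.symm⟩]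
  · intro hb
    rw [card_eq_zero, filter_eq_empty_iff]
    rintro r hr ⟨hr4, hx⟩
    rw [mem_range] at hr
    apply hb
    interval_cases r
    · omega
    · exact Or.inr (Or.inl (hx.symm.trans e1))
    · exact Or.inl (hx.symm.trans e2)
    · exact Or.inr (Or.inl (hx.symm.trans e3))
    · omega
    · exact Or.inr (Or.inr (hx.symm.trans e5))
    · exact Or.inl (hx.symm.trans e6)
    · exact Or.inr (Or.inr (hx.symm.trans e7))

theorem ternaryLaw_lucasU (hP : ¬ (3 : ℤ) ∣ P) (hδ1 : 1 ≤ δ) (hδ : (3 : ℤ) ^ δ ∣ P ^ 2 + 2)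
    (hδ' : ¬ (3 : ℤ) ^ (δ + 1) ∣ P ^ 2 + 2) : TernaryLaw (lucasU P) δ 2 1 := by
  have hanti (n : ℕ) : lucasU P (n + 4) ≡ -lucasU P n [ZMOD 3 ^ δ] := by
    simpa using lucasU_antiperiod hP hδ1 hδ hδ' 0 n
  refine ⟨hδ1, lucasU_antiperiod hP hδ1 hδ hδ', fun k n m h8 hn ↦ ?_, fun k n m h8 hn ↦ ?_,
    fun n ↦ (three_dvd_lucasU_iff hP n).trans (by omega), even_two, by norm_num,
    lucasU_card_regular hP hδ1 hδ hanti, fun h2 n hn ↦ ?_, ?_⟩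
  · refine modEq_iff_of_symm (C := fun n ↦ n % 4 = 2)
      (f := fun n m ↦ 3 ^ (2 * δ) * (((n : ℤ) - m) * (n + m))) (fun n m ↦ by ring)
      (fun n b hn hb ↦ ?_) k hn (by omega) h8
    rw [emultiplicity_three_critical, lucasU_sub n (Nat.even_iff.2 (by omega)),
      emultiplicity_mul Int.prime_three, emultiplicity_three_lucasV hP hδ1 hδ hδ' (by omega),
      emultiplicity_three_lucasU hP hδ1 hδ hδ' (by omega)]
  · refine modEq_iff_of_symm (C := fun n ↦ n % 4 ≠ 2)
      (f := fun n m ↦ 3 ^ δ * ((n : ℤ) - m)) (fun n m ↦ by ring)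
      (fun n b hn hb ↦ ?_) k hn (by omega) h8
    rw [emultiplicity_three_regular, lucasU_sub n (Nat.even_iff.2 (by omega)),
      emultiplicity_mul Int.prime_three,
      emultiplicity_three_eq_zero (z := lucasV P _) (by rw [three_dvd_lucasV_iff hP]; omega),
      emultiplicity_three_lucasU hP hδ1 hδ hδ' (by omega), zero_add]
  -- Critical values are ±P ≡ ±4 (mod 9), regular ones 0 or ±1.
  · have h9 : (9 : ℤ) ∣ 3 ^ δ := pow_dvd_pow (3 : ℤ) h2
    have hP9 := emod_nine_of_dvd hδ h2
    have h := modEq_or_modEq_neg_of_antiperiod hanti n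
    rw [hn, show lucasU P 2 = P by simp [lucasU]] at h
    unfold PmModEq
    push_cast
    intro hx
    have h' := h.imp (Int.ModEq.of_dvd h9) (Int.ModEq.of_dvd h9)
    have hx' := hx.imp (Int.ModEq.of_dvd h9) (Or.imp (Int.ModEq.of_dvd h9) (Int.ModEq.of_dvd h9))
    unfold Int.ModEq at h' hx'
    omega
  · rintro rfl b
    unfold PmModEq Int.ModEq
    push_cast
    omega

theorem ternaryLaw_lucasV (hP : ¬ (3 : ℤ) ∣ P) (hδ1 : 1 ≤ δ) (hδ : (3 : ℤ) ^ δ ∣ P ^ 2 + 2)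
    (hδ' : ¬ (3 : ℤ) ^ (δ + 1) ∣ P ^ 2 + 2) : TernaryLaw (lucasV P) δ 0 P := by
  have hanti (n : ℕ) : lucasV P (n + 4) ≡ -lucasV P n [ZMOD 3 ^ δ] := by
    simpa using lucasV_antiperiod hP hδ1 hδ hδ' 0 n
  have hD : emultiplicity 3 (P ^ 2 + 4) = 0 := by
    have := sq_emod_three hP
    exact emultiplicity_three_eq_zero (by omega)
  refine ⟨hδ1, lucasV_antiperiod hP hδ1 hδ hδ', fun k n m h8 hn ↦ ?_, fun k n m h8 hn ↦ ?_,
    fun n ↦ (three_dvd_lucasV_iff hP n).trans (by omega), by simp, by norm_num,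
    lucasV_card_regular hP hδ1 hδ hanti, fun h2 n hn ↦ ?_, ?_⟩
  · refine modEq_iff_of_symm (C := fun n ↦ n % 4 = 0)
      (f := fun n m ↦ 3 ^ (2 * δ) * (((n : ℤ) - m) * (n + m))) (fun n m ↦ by ring)
      (fun n b hn hb ↦ ?_) k hn (by omega) h8
    rw [emultiplicity_three_critical, lucasV_sub n (Nat.even_iff.2 (by omega)),
      emultiplicity_mul Int.prime_three, emultiplicity_mul Int.prime_three, hD, zero_add,
      emultiplicity_three_lucasU hP hδ1 hδ hδ' (by omega),
      emultiplicity_three_lucasU hP hδ1 hδ hδ' (by omega)]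
  · refine modEq_iff_of_symm (C := fun n ↦ n % 4 ≠ 0)
      (f := fun n m ↦ 3 ^ δ * ((n : ℤ) - m)) (fun n m ↦ by ring)
      (fun n b hn hb ↦ ?_) k hn (by omega) h8
    rw [emultiplicity_three_regular, lucasV_sub n (Nat.even_iff.2 (by omega)),
      emultiplicity_mul Int.prime_three, emultiplicity_mul Int.prime_three, hD, zero_add,
      emultiplicity_three_eq_zero (z := lucasU P (n + b)) (by rw [three_dvd_lucasU_iff hP]; omega),
      emultiplicity_three_lucasU hP hδ1 hδ hδ' (by omega), zero_add]
  -- Critical values are ±2 modulo 9, regular ones 0 or ±P ≡ ±4.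
  · have h9 : (9 : ℤ) ∣ 3 ^ δ := pow_dvd_pow (3 : ℤ) h2
    have hP9 := emod_nine_of_dvd hδ h2
    have h := modEq_or_modEq_neg_of_antiperiod hanti n
    rw [hn, show lucasV P 0 = 2 from rfl] at h
    unfold PmModEq
    push_cast
    intro hx
    have h' := h.imp (Int.ModEq.of_dvd h9) (Int.ModEq.of_dvd h9)
    have hx' := hx.imp (Int.ModEq.of_dvd h9) (Or.imp (Int.ModEq.of_dvd h9) (Int.ModEq.of_dvd h9))
    unfold Int.ModEq at h' hx'
    omega
  · rintro rfl b
    unfold PmModEq Int.ModEq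
    push_cast
    omega

end

/-! ### Reference indices and the theorem -/

theorem not_three_pow_succ_dvd_mul {c : ℕ} (hc : ¬ 3 ∣ c) (j : ℕ) : ¬ 3 ^ (j + 1) ∣ c * 3 ^ j := by
  rw [pow_succ, mul_comm c, mul_dvd_mul_iff_left (by positivity)]
  exact hc

theorem two_mul_three_pow_mod_four (j : ℕ) : 2 * 3 ^ j % 4 = 2 := by
  have hodd : 3 ^ j % 2 = 1 := Nat.odd_iff.1 (Odd.pow (by decide))
  omega

theorem theorem1 (P : ℤ) (hP : ¬ (3 : ℤ) ∣ P) (δ : ℕ)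
    (hδ : (3 : ℤ) ^ δ ∣ P ^ 2 + 2 ∧ ¬ (3 : ℤ) ^ (δ + 1) ∣ P ^ 2 + 2) :
    -- the case `δ = 1`
    (δ = 1 → ∀ k : ℕ, 1 ≤ k → ∀ b : ℤ,
      ((PmModEq (3 ^ k) b (lucasU P (2 * 3 ^ (2 * ((k - 1) / 4) + 1))) →
          residueFreq (lucasU P) (3 ^ k) b = 3 ^ (k / 2) + 2) ∧
        (∀ l : ℕ, 1 ≤ l → l ≤ (k - 1) / 2 →
          PmModEq (3 ^ (2 * l + 1)) b (lucasU P (2 * 3 ^ (l - 1))) →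
          residueFreq (lucasU P) (3 ^ k) b = 2 * 3 ^ l + 2) ∧
        (¬ PmModEq (3 ^ k) b (lucasU P (2 * 3 ^ (2 * ((k - 1) / 4) + 1))) →
          (¬ ∃ l : ℕ, 1 ≤ l ∧ l ≤ (k - 1) / 2 ∧
            PmModEq (3 ^ (2 * l + 1)) b (lucasU P (2 * 3 ^ (l - 1)))) →
          residueFreq (lucasU P) (3 ^ k) b = 2)) ∧
      ((PmModEq (3 ^ k) b 2 →
          residueFreq (lucasV P) (3 ^ k) b = 3 ^ (k / 2) + 2) ∧
        (∀ l : ℕ, 1 ≤ l → l ≤ (k - 1) / 2 →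
          PmModEq (3 ^ (2 * l + 1)) b (lucasV P (4 * 3 ^ (l - 1))) →
          residueFreq (lucasV P) (3 ^ k) b = 2 * 3 ^ l + 2) ∧
        (¬ PmModEq (3 ^ k) b 2 →
          (¬ ∃ l : ℕ, 1 ≤ l ∧ l ≤ (k - 1) / 2 ∧
            PmModEq (3 ^ (2 * l + 1)) b (lucasV P (4 * 3 ^ (l - 1)))) →
          residueFreq (lucasV P) (3 ^ k) b = 2))) ∧
    -- the case `δ ≥ 2`, `k ≥ 2δ - 1`
    (2 ≤ δ → ∀ k : ℕ, 2 * δ - 1 ≤ k → ∀ b : ℤ,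
      ((PmModEq (3 ^ k) b (lucasU P (2 * 3 ^ (2 * ((k - (2 * δ - 1)) / 4) + 1))) →
          residueFreq (lucasU P) (3 ^ k) b = 3 ^ (k / 2)) ∧
        (∀ l : ℕ, δ ≤ l → l ≤ (k - 1) / 2 →
          PmModEq (3 ^ (2 * l + 1)) b (lucasU P (2 * 3 ^ (l - δ))) →
          residueFreq (lucasU P) (3 ^ k) b = 2 * 3 ^ l) ∧
        (b ≡ 0 [ZMOD 3 ^ δ] ∨ PmModEq (3 ^ δ) b 1 →
          residueFreq (lucasU P) (3 ^ k) b = 2) ∧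
        (¬ PmModEq (3 ^ k) b (lucasU P (2 * 3 ^ (2 * ((k - (2 * δ - 1)) / 4) + 1))) →
          (¬ ∃ l : ℕ, δ ≤ l ∧ l ≤ (k - 1) / 2 ∧
            PmModEq (3 ^ (2 * l + 1)) b (lucasU P (2 * 3 ^ (l - δ)))) →
          ¬ (b ≡ 0 [ZMOD 3 ^ δ] ∨ PmModEq (3 ^ δ) b 1) →
          residueFreq (lucasU P) (3 ^ k) b = 0)) ∧
      ((PmModEq (3 ^ k) b 2 →
          residueFreq (lucasV P) (3 ^ k) b = 3 ^ (k / 2)) ∧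
        (∀ l : ℕ, δ ≤ l → l ≤ (k - 1) / 2 →
          PmModEq (3 ^ (2 * l + 1)) b (lucasV P (4 * 3 ^ (l - δ))) →
          residueFreq (lucasV P) (3 ^ k) b = 2 * 3 ^ l) ∧
        (b ≡ 0 [ZMOD 3 ^ δ] ∨ PmModEq (3 ^ δ) b P →
          residueFreq (lucasV P) (3 ^ k) b = 2) ∧
        (¬ PmModEq (3 ^ k) b 2 →
          (¬ ∃ l : ℕ, δ ≤ l ∧ l ≤ (k - 1) / 2 ∧
            PmModEq (3 ^ (2 * l + 1)) b (lucasV P (4 * 3 ^ (l - δ)))) →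
          ¬ (b ≡ 0 [ZMOD 3 ^ δ] ∨ PmModEq (3 ^ δ) b P) →
          residueFreq (lucasV P) (3 ^ k) b = 0))) ∧
    -- the case `δ ≥ 2`, `δ ≤ k < 2δ - 1`
    (2 ≤ δ → ∀ k : ℕ, δ ≤ k → k < 2 * δ - 1 → ∀ b : ℤ,
      ((PmModEq (3 ^ k) b P →
          residueFreq (lucasU P) (3 ^ k) b = 3 ^ (k - δ)) ∧
        (b ≡ 0 [ZMOD 3 ^ δ] ∨ PmModEq (3 ^ δ) b 1 →
          residueFreq (lucasU P) (3 ^ k) b = 2) ∧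
        (¬ PmModEq (3 ^ k) b P →
          ¬ (b ≡ 0 [ZMOD 3 ^ δ] ∨ PmModEq (3 ^ δ) b 1) →
          residueFreq (lucasU P) (3 ^ k) b = 0)) ∧
      ((PmModEq (3 ^ k) b 2 →
          residueFreq (lucasV P) (3 ^ k) b = 3 ^ (k - δ)) ∧
        (b ≡ 0 [ZMOD 3 ^ δ] ∨ PmModEq (3 ^ δ) b P →
          residueFreq (lucasV P) (3 ^ k) b = 2) ∧
        (¬ PmModEq (3 ^ k) b 2 →
          ¬ (b ≡ 0 [ZMOD 3 ^ δ] ∨ PmModEq (3 ^ δ) b P) →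
          residueFreq (lucasV P) (3 ^ k) b = 0))) ∧
    -- neither sequence is stable modulo `3`
    (¬ IsStableMod (lucasU P) 3 ∧ ¬ IsStableMod (lucasV P) 3) := by
  obtain ⟨hδ, hδ'⟩ := hδ
  have hδ1 : 1 ≤ δ := by
    rcases δ with - | δ
    · have := sq_emod_three hP
      exact absurd (show (3 : ℤ) ^ (0 + 1) ∣ P ^ 2 + 2 by omega) hδ'
    · omega
  have hU := ternaryLaw_lucasU hP hδ1 hδ hδ'
  have hV := ternaryLaw_lucasV hP hδ1 hδ hδ'
  have u1 (j : ℕ) : 3 ^ j ∣ 2 * 3 ^ j := dvd_mul_left _ _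
  have u2 (j : ℕ) : ¬ 3 ^ (j + 1) ∣ 2 * 3 ^ j := not_three_pow_succ_dvd_mul (by norm_num) j
  have v0 (j : ℕ) : 4 * 3 ^ j % 4 = 0 := Nat.mul_mod_right _ _
  have v1 (j : ℕ) : 3 ^ j ∣ 4 * 3 ^ j := dvd_mul_left _ _
  have v2 (j : ℕ) : ¬ 3 ^ (j + 1) ∣ 4 * 3 ^ j := not_three_pow_succ_dvd_mul (by norm_num) j
  -- Any critical index whose square is divisible by 3^(K-δ) can serve as r₀. The exponent
  -- 2⌊(k-2δ+1)/4⌋ + 1 in the statement is large enough; for v the index 0 serves, with v_0 = 2.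
  have udeep {K t : ℕ} (ht : K - δ ≤ 2 * t) : 3 ^ (K - δ) ∣ (2 * 3 ^ t) ^ 2 := by
    rw [three_pow_dvd_sq_iff]
    exact (pow_dvd_pow 3 (by omega)).mul_left 2
  have vdeep (K : ℕ) : 3 ^ (K - δ) ∣ 0 ^ 2 := by simp
  refine ⟨?_, ?_, ?_, hU.not_isStableMod, hV.not_isStableMod⟩
  · rintro h1 k hk b
    obtain ⟨K, rfl⟩ := Nat.exists_eq_add_of_le (h1 ▸ hk : δ ≤ k)
    have hu := hU.residueFreq_of_eq_one h1 (K := K) (r := fun j ↦ 2 * 3 ^ j)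
      (two_mul_three_pow_mod_four (2 * ((δ + K - 1) / 4) + 1)) (udeep (by omega))
      two_mul_three_pow_mod_four u1 u2 b
    have hv := hV.residueFreq_of_eq_one h1 (K := K) (r := fun j ↦ 4 * 3 ^ j) (Nat.zero_mod 4)
      (vdeep K) v0 v1 v2 b
    subst h1
    exact ⟨hu, hv⟩
  · intro h2 k hk b
    obtain ⟨K, rfl⟩ := Nat.exists_eq_add_of_le (show δ ≤ k by omega)
    exact ⟨hU.residueFreq_of_two_le h2 (r := fun j ↦ 2 * 3 ^ j) hk
      (two_mul_three_pow_mod_four (2 * ((δ + K - (2 * δ - 1)) / 4) + 1)) (udeep (by omega))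
      two_mul_three_pow_mod_four u1 u2 b,
      hV.residueFreq_of_two_le h2 (r := fun j ↦ 4 * 3 ^ j) hk (Nat.zero_mod 4) (vdeep K) v0 v1 v2 b⟩
  · intro h2 k hk hk' b
    obtain ⟨K, rfl⟩ := Nat.exists_eq_add_of_le hk
    have hu := hU.residueFreq_of_lt h2 (r₀ := 2) hk' rfl two_mul_three_pow_mod_four u1 u2 b
    rw [show lucasU P 2 = P by simp [lucasU]] at hu
    exact ⟨hu, hV.residueFreq_of_lt h2 hk' (Nat.zero_mod 4) v0 v1 v2 b⟩
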